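/- Let $\alpha>1$. Consider the fractional BBM equation $$u_t+D^\alpha u_t+u_x+uu_x=0,\qquad u(0,x)=u_0(x),\qquad x\in\mathbb R,$$ for real-valued $u$, where $\widehat f(\xi)=\int_{\mathbb R}e^{-ix\xi}f(x)\,dx$, $\widehat{D^s f}(\xi)=|\xi|^s\widehat f(\xi)$ and $\|f\|_{H^s}=\big(\int_{\mathbb R}(1+|\xi|)^{2s}|\widehat f(\xi)|^2\,d\xi\big)^{1/2}$. For $\sigma>0$ let $I=I_\sigma$ be the Fourier multiplier with symbol $m(\xi)=\frac12(e^{\sigma\xi}+e^{-\sigma\xi})$. By a solution on $[0,\delta]$ we mean a real-valued $u$ with $u(0)=u_0$ and $Iu\in C([0,\delta];H^{\alpha/2}(\mathbb R))$ which is differentiable in time with values in $L^2(\mathbb R)$ (one-sidedly at the end points) and satisfies the equation almost everywhere in $x$ for each $t\in[0,\delta]$, all its terms being $L^2$ functions. There are constants $c>0$ and $C>0$ depending only on $\alpha$ such that for every $\sigma>0$ and every real-valued $u_0\in L^2(\mathbb R)$ with $Iu_0\in H^{\alpha/2}(\mathbb R)$ the following holds. (1) For every $\delta>0$ with $\delta\,\|Iu_0\|_{H^{\alpha/2}}\le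 c$ there is exactly one solution on $[0,\delta]$, and it satisfies $$\sup_{t\in[0,\delta]}\|Iu(t)\|_{H^{\alpha/2}}\le 2\|Iu_0\|_{H^{\alpha/2}}.\qquad(*)$$ (2) For every $\delta>0$ and every solution $u$ on $[0,\delta]$ that satisfies $(*)$ (in particular for the one in (1)), the energy $E(t)=\int_{\mathbb R}\big(|Iu(t)|^2+|D^{\alpha/2}Iu(t)|^2\big)\,dx$ satisfies $$E(\delta)\le E(0)+C\,\delta\,\sigma^{\beta}\,\|Iu_0\|_{H^{\alpha/2}}^3,$$ where $$\beta=\begin{cases}\frac32(\alpha-1)&\text{if }1<\alpha<\frac73,\\ 2&\text{if }\alpha\ge\frac73.\end{cases}$$ -/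

import Mathlib

open MeasureTheory Set Filter Topology FourierTransform

namespace FBBM

noncomputable section

/-- Square integrable functions on the real line (up to a.e. equality). -/
abbrev L2 : Type := Lp (α := ℝ) ℂ 2

/-- The function is real-valued. -/
def IsRealValued (f : L2) : Prop := ∀ᵐ x : ℝ, (f x).im = 0

/-- The Fourier transform in the normalisation `∫ e^{-i x ξ} f(x) dx`; Mathlib's normalisation is
`∫ e^{-2π i x η} f(x) dx`, so that `ξ = 2π η`. -/
def fhat (f : L2) (ξ : ℝ) : ℂ := (𝓕 f : L2) (ξ / (2 * Real.pi))

/-- `f` lies in the `L²` domain of the Fourier multiplier with symbol `a = a(ξ)`, that is,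
`a(ξ) f̂(ξ)` is square integrable (written in the variable `η = ξ / 2π`). -/
def InDomain (a : ℝ → ℂ) (f : L2) : Prop :=
  MemLp (fun η : ℝ => a (2 * Real.pi * η) * (𝓕 f : L2) η) 2 volume

open Classical in
/-- The Fourier multiplier `f ↦ F⁻¹ (a(ξ) f̂(ξ))` on its `L²` domain (and `0` elsewhere). -/
def multiplier (a : ℝ → ℂ) (f : L2) : L2 :=
  if h : InDomain a f then 𝓕⁻ (MemLp.toLp _ h : L2) else 0

/-- The symbol `m(ξ) = (e^{σ ξ} + e^{-σ ξ}) / 2` of the operator `I`. -/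
def mSymbol (σ : ℝ) (ξ : ℝ) : ℂ := (((Real.exp (σ * ξ) + Real.exp (-(σ * ξ))) / 2 : ℝ) : ℂ)

/-- The symbol `|ξ|^s` of `D^s`. -/
def dSymbol (s : ℝ) (ξ : ℝ) : ℂ := ((|ξ| ^ s : ℝ) : ℂ)

/-- The symbol `i ξ` of `∂ₓ`. -/
def dxSymbol (ξ : ℝ) : ℂ := Complex.I * (ξ : ℂ)

/-- The operator `I` with parameter `σ`. -/
def opI (σ : ℝ) (f : L2) : L2 := multiplier (mSymbol σ) f

/-- The operator `D^s`. -/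
def opD (s : ℝ) (f : L2) : L2 := multiplier (dSymbol s) f

/-- The spatial derivative `∂ₓ`. -/
def opDx (f : L2) : L2 := multiplier dxSymbol f

/-- `f ∈ H^s(ℝ)`, for `f ∈ L²` and `s ≥ 0`. -/
def MemHs (s : ℝ) (f : L2) : Prop :=
  Integrable (fun ξ : ℝ => (1 + |ξ|) ^ (2 * s) * ‖fhat f ξ‖ ^ 2) volume

/-- The norm `‖f‖_{H^s} = (∫ (1 + |ξ|)^{2s} |f̂(ξ)|² dξ)^{1/2}`. -/
def normHs (s : ℝ) (f : L2) : ℝ :=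
  Real.sqrt (∫ ξ : ℝ, (1 + |ξ|) ^ (2 * s) * ‖fhat f ξ‖ ^ 2)

/-- `If` is defined (as an `L²` function) and belongs to `H^s(ℝ)`. -/
def OpIMemHs (σ s : ℝ) (f : L2) : Prop := InDomain (mSymbol σ) f ∧ MemHs s (opI σ f)

/-- `w` solves `u_t + D^α u_t + u_x + u u_x = 0` at the time `t` of the interval `J`: the time
derivative `u_t` exists in `L²` (one-sided at the end points of `J`), `D^α u_t` and `u_x` are `L²`
functions, and the equation holds almost everywhere. -/
def SolvesAt (α : ℝ) (J : Set ℝ) (w : ℝ → L2) (t : ℝ) : Prop :=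
  ∃ wt : L2, HasDerivWithinAt w wt J t ∧ InDomain (dSymbol α) wt ∧ InDomain dxSymbol (w t) ∧
    ∀ᵐ x : ℝ, wt x + opD α wt x + opDx (w t) x + w t x * opDx (w t) x = 0

/-- `u` is a real-valued solution on `[0, δ]` of the fractional BBM equation with initial value
`u₀` and with `Iu ∈ C([0, δ]; H^{α/2}(ℝ))`. -/
structure IsSolution (α σ δ : ℝ) (u₀ : L2) (u : ℝ → L2) : Prop where
  initial : u 0 = u₀
  real_valued : ∀ t ∈ Icc 0 δ, IsRealValued (u t)
  mem : ∀ t ∈ Icc 0 δ, OpIMemHs σ (α / 2) (u t)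
  cont : ∀ t ∈ Icc 0 δ,
    Tendsto (fun s => normHs (α / 2) (opI σ (u s) - opI σ (u t))) (𝓝[Icc 0 δ] t) (𝓝 0)
  equation : ∀ t ∈ Icc 0 δ, SolvesAt α (Icc 0 δ) u t

/-- The local bound `sup_{t ∈ [0, δ]} ‖Iu(t)‖_{H^{α/2}} ≤ 2 ‖Iu₀‖_{H^{α/2}}`. -/
def LocalBound (α σ δ : ℝ) (u₀ : L2) (u : ℝ → L2) : Prop :=
  ∀ t ∈ Icc 0 δ, normHs (α / 2) (opI σ (u t)) ≤ 2 * normHs (α / 2) (opI σ u₀)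

/-- The modified energy `∫ (|If|² + |D^{α/2} If|²) dx`. -/
def energy (α σ : ℝ) (f : L2) : ℝ :=
  ∫ x : ℝ, (‖opI σ f x‖ ^ 2 + ‖opD (α / 2) (opI σ f) x‖ ^ 2)

open Classical in
/-- The exponent `β`: `(3/2)(α - 1)` for `α < 7/3` and `2` for `α ≥ 7/3`. -/
def beta (α : ℝ) : ℝ := if α < 7 / 3 then 3 / 2 * (α - 1) else 2

end

end FBBM

/-! Put W(ξ) = (1+|ξ|)^{α/2} cosh(σξ) and write û = g/W. Then ‖Iu‖_{H^{α/2}} is √(2π)‖g‖ in L² of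
the variable η = ξ/2π, and the equation becomes g' = Ag + Q(g,g), where A is multiplication by
-iξ/(1+|ξ|^α) and Q(g,h) = ½ A·W((g/W)*(h/W)) (`solvesAt_iff`).

Well-posedness. A is bounded and skew-adjoint. Q is bounded uniformly in σ, because cosh(a+b) ≤ 2
cosh a cosh b and (1+|ξ|)^{-α/2} is square integrable for α > 1 (`exists_isConvWeight`). Picard
iteration for e^{-tA}g does not see A, so only δ‖g(0)‖ has to be small
(`exists_hasDerivWithinAt_quadratic`). A Grönwall argument gives uniqueness. Real-valuedness is the
symmetry `conjNeg g = g`, which the flow preserves.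

Energy. In E' the density 1+|ξ|^α cancels the denominator of the symbol and the linear part drops
out. Since cosh(a+b)/(cosh a cosh b) = 1 + tanh a tanh b, the cubic term is that of -∫ Iu ∂ₓ(Iu)²,
which vanishes for real functions (`integral_flux_eq_zero`), plus a remainder carrying two tanh
factors (`inner_vectorField`). With |tanh z| ≤ |z|^θ, each factor gains σ^θ and costs θ powers of
frequency. Replacing α by a = min(α, 7/3) and the weights by powers of |ξ| leaves the kernel
|x|^{-q}|y|^{-p}|x-y|^{-p} with q = a/2-1, p = a/2-θ. The trilinear form is bounded on L² when 2p+q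
= 1/2 (`triIntegral_homogeneous_le`), that is θ = 3(a-1)/4. The constraint θ ≤ 1 is a ≤ 7/3, and β =
2θ. Integrating in time with the local bound finishes the proof. -/

namespace FBBM

/-! ### Pointwise formulas for the inverse Fourier transform -/

section FourierInverse

open scoped Convolution SchwartzMap ContDiff

/-- On `L¹ ∩ L²` the `L²` inverse Fourier transform is given by the Fourier integral. -/
theorem coeFn_fourierInv_toLp {φ : ℝ → ℂ} (h₁ : Integrable φ) (h₂ : MemLp φ 2 volume) :
    ((𝓕⁻ (h₂.toLp φ : L2) : L2) : ℝ → ℂ) =ᵐ[volume] (𝓕⁻ φ : ℝ → ℂ) := by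
  have hcont : Continuous (𝓕⁻ φ : ℝ → ℂ) := by
    have : (𝓕⁻ φ : ℝ → ℂ) = fun x => 𝓕 φ (-x) := by
      ext x; exact Real.fourierInv_eq_fourier_neg φ x
    rw [this]
    exact (VectorFourier.fourierIntegral_continuous Real.continuous_fourierChar
      (by fun_prop) h₁).comp continuous_neg
  apply ae_eq_of_integral_contDiff_smul_eq
  · exact (Lp.memLp _).locallyIntegrable (by norm_num)
  · exact hcont.locallyIntegrable
  · intro g g_smooth g_cpt
    have hg₁ : HasCompactSupport (Complex.ofRealCLM ∘ g) := g_cpt.comp_left rfl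
    have hg₂ : ContDiff ℝ ∞ (Complex.ofRealCLM ∘ g) := by fun_prop
    set G : 𝓢(ℝ, ℂ) := hg₁.toSchwartzMap hg₂ with hG
    -- Both sides are compared as distributions: the L² transform is moved onto the test function
    -- `G` by duality, and Fubini (`e3`) moves it back onto φ as a Fourier integral.
    have key := congrArg (fun T => T G)
      (Lp.fourierInv_toTemperedDistribution_eq (h₂.toLp φ : L2))
    simp only [TemperedDistribution.fourierInv_apply, Lp.toTemperedDistribution_apply] at key
    have hGx : ∀ x, G x = (g x : ℂ) := fun x => rfl
    have e1 : ∫ x, g x • (𝓕⁻ (h₂.toLp φ : L2) : L2) x =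
        ∫ x, G x • (𝓕⁻ (h₂.toLp φ : L2) : L2) x := by
      congr 1
    rw [e1, ← key]
    have e2 : ∫ x, (𝓕⁻ G : 𝓢(ℝ, ℂ)) x • (h₂.toLp φ : L2) x =
        ∫ x, (𝓕⁻ G : 𝓢(ℝ, ℂ)) x • φ x := by
      apply integral_congr_ae
      filter_upwards [h₂.coeFn_toLp] with x hx
      rw [hx]
    rw [e2]
    have e3 := VectorFourier.integral_fourierIntegral_smul_eq_flip (μ := volume) (ν := volume)
      (e := Real.fourierChar) (L := -innerₗ ℝ) Real.continuous_fourierChar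
      (by simpa using (by fun_prop : Continuous fun p : ℝ × ℝ => -(p.2 * p.1))) G.integrable h₁
    have e4 : ∀ x, (𝓕⁻ G : 𝓢(ℝ, ℂ)) x =
        VectorFourier.fourierIntegral Real.fourierChar volume (-innerₗ ℝ) G x := by
      intro x
      rw [SchwartzMap.fourierInv_coe, Real.fourierInv_eq]
      simp [VectorFourier.fourierIntegral]
    have e5 : ∀ x, (𝓕⁻ φ : ℝ → ℂ) x =
        VectorFourier.fourierIntegral Real.fourierChar volume (-innerₗ ℝ).flip φ x := by
      intro x
      rw [Real.fourierInv_eq]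
      simp [VectorFourier.fourierIntegral, mul_comm]
    simp_rw [e4, e5, e3, hGx]
    rfl

/-- The inverse Fourier transform takes convolutions to products. -/
theorem fourierInv_convolution {φ ψ : ℝ → ℂ} (hφ : Integrable φ) (hψ : Integrable ψ) (x : ℝ) :
    (𝓕⁻ (φ ⋆[ContinuousLinearMap.mul ℂ ℂ, volume] ψ) : ℝ → ℂ) x =
      (𝓕⁻ φ : ℝ → ℂ) x * (𝓕⁻ ψ : ℝ → ℂ) x := by
  simp only [Real.fourierInv_eq_fourier_neg]
  exact Real.fourier_mul_convolution_eq hφ hψ _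

/-- Conjugation of an inverse Fourier transform. -/
theorem conj_fourierInv (φ : ℝ → ℂ) (x : ℝ) :
    (starRingEnd ℂ) ((𝓕⁻ φ : ℝ → ℂ) x) =
      (𝓕⁻ (fun η => (starRingEnd ℂ) (φ (-η))) : ℝ → ℂ) x := by
  rw [Real.fourierInv_eq, Real.fourierInv_eq, ← integral_conj,
    ← integral_neg_eq_self (fun v => (starRingEnd ℂ) (Real.fourierChar (inner ℝ v x) • φ v))]
  congr 1
  ext v
  simp only [Circle.smul_def, Real.fourierChar_apply, smul_eq_mul, map_mul, ← Complex.exp_conj]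
  congr 2
  simp [Complex.conj_ofNat]

end FourierInverse

/-! ### Bounded multiplication operators on L² -/

/-- A bounded measurable symbol. -/
structure IsBddSymbol (a : ℝ → ℂ) : Prop where
  meas : Measurable a
  bdd : ∃ C, 0 ≤ C ∧ ∀ x, ‖a x‖ ≤ C

theorem IsBddSymbol.memLp {a : ℝ → ℂ} (ha : IsBddSymbol a) {f : ℝ → ℂ} (hf : MemLp f 2 volume) :
    MemLp (fun x => a x * f x) 2 volume := by
  obtain ⟨C, -, hC⟩ := ha.bdd
  exact hf.of_le_mul (c := C) (ha.meas.aestronglyMeasurable.mul hf.1)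
    (Eventually.of_forall fun x => by
      rw [norm_mul]; exact mul_le_mul_of_nonneg_right (hC x) (norm_nonneg _))

theorem norm_toLp_le_mul_norm {f : ℝ → ℂ} (hf : MemLp f 2 volume) {C : ℝ} (g : L2)
    (h : ∀ᵐ x, ‖f x‖ ≤ C * ‖g x‖) : ‖(hf.toLp f : L2)‖ ≤ C * ‖g‖ := by
  apply Lp.norm_le_mul_norm_of_ae_le_mul
  filter_upwards [h, hf.coeFn_toLp] with x hx h2
  rw [h2]; exact hx

/-- Multiplication by a bounded measurable symbol, as an operator on `L²`. -/
noncomputable def mulOp (a : ℝ → ℂ) (ha : IsBddSymbol a) : L2 →L[ℂ] L2 :=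
  LinearMap.mkContinuousOfExistsBound
    { toFun := fun g => (ha.memLp (Lp.memLp g)).toLp _
      map_add' := fun f g => by
        rw [← MemLp.toLp_add]
        apply MemLp.toLp_congr
        filter_upwards [Lp.coeFn_add f g] with x hx
        simp only [hx, Pi.add_apply, mul_add]
      map_smul' := fun c g => by
        rw [RingHom.id_apply, ← MemLp.toLp_const_smul]
        apply MemLp.toLp_congr
        filter_upwards [Lp.coeFn_smul c g] with x hx
        simp only [hx, Pi.smul_apply, smul_eq_mul]
        ring }
    (by
      obtain ⟨C, -, hC⟩ := ha.bdd
      refine ⟨C, fun g => norm_toLp_le_mul_norm (ha.memLp (Lp.memLp g)) g (Eventually.of_forall fun x => ?_)⟩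
      rw [norm_mul]; exact mul_le_mul_of_nonneg_right (hC x) (norm_nonneg _))

theorem coeFn_mulOp {a : ℝ → ℂ} (ha : IsBddSymbol a) (g : L2) :
    mulOp a ha g =ᵐ[volume] fun x => a x * g x :=
  (ha.memLp (Lp.memLp g)).coeFn_toLp

theorem norm_mulOp_le {a : ℝ → ℂ} (ha : IsBddSymbol a) {C : ℝ} (hC : ∀ x, ‖a x‖ ≤ C) (g : L2) :
    ‖mulOp a ha g‖ ≤ C * ‖g‖ := by
  apply Lp.norm_le_mul_norm_of_ae_le_mul
  filter_upwards [coeFn_mulOp ha g] with x hx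
  rw [hx, norm_mul]; exact mul_le_mul_of_nonneg_right (hC x) (norm_nonneg _)

theorem measurePreserving_neg_real : MeasurePreserving (fun x : ℝ => -x) volume volume :=
  Measure.measurePreserving_neg volume

theorem memLp_conjNeg (g : L2) : MemLp (fun x => (starRingEnd ℂ) (g (-x))) 2 volume :=
  ((Lp.memLp g).comp_measurePreserving measurePreserving_neg_real).star

/-- The conjugate reflection `g ↦ conj (g (-·))`, which is complex conjugation on the Fourier
side. -/
noncomputable def conjNeg : L2 →L[ℝ] L2 :=
  LinearMap.mkContinuous
    { toFun := fun g => (memLp_conjNeg g).toLp _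
      map_add' := fun f g => by
        rw [← MemLp.toLp_add]
        apply MemLp.toLp_congr
        filter_upwards [measurePreserving_neg_real.quasiMeasurePreserving.ae_eq_comp
          (Lp.coeFn_add f g)] with x hx
        simp only [Function.comp, Pi.add_apply] at hx
        simp only [hx, Pi.add_apply, map_add]
      map_smul' := fun c g => by
        rw [RingHom.id_apply, ← MemLp.toLp_const_smul]
        apply MemLp.toLp_congr
        filter_upwards [measurePreserving_neg_real.quasiMeasurePreserving.ae_eq_comp
          (Lp.coeFn_smul c g)] with x hx
        simp only [Function.comp, Pi.smul_apply] at hx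
        simp [hx] }
    1 (fun g => by
      simp only [LinearMap.coe_mk, AddHom.coe_mk, one_mul, Lp.norm_toLp]
      rw [Lp.norm_def]
      apply ENNReal.toReal_mono (Lp.memLp g).2.ne
      have := eLpNorm_comp_measurePreserving (p := 2) (Lp.memLp g).1 measurePreserving_neg_real
      rw [← this]
      exact eLpNorm_mono fun x => by simp)

theorem coeFn_conjNeg (g : L2) :
    conjNeg g =ᵐ[volume] fun x => (starRingEnd ℂ) (g (-x)) :=
  (memLp_conjNeg g).coeFn_toLp

theorem conjNeg_mulOp {a : ℝ → ℂ} (ha : IsBddSymbol a)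
    (hsymm : ∀ x, (starRingEnd ℂ) (a (-x)) = a x) (g : L2) :
    conjNeg (mulOp a ha g) = mulOp a ha (conjNeg g) := by
  apply Lp.ext
  have h1 := measurePreserving_neg_real.quasiMeasurePreserving.ae_eq_comp (coeFn_mulOp ha g)
  filter_upwards [coeFn_conjNeg (mulOp a ha g), h1, coeFn_mulOp ha (conjNeg g), coeFn_conjNeg g]
    with x e1 e2 e3 e4
  simp only [Function.comp] at e2
  rw [e1, e3, e4, e2, map_mul, hsymm]

theorem inner_mulOp_left {a : ℝ → ℂ} (ha : IsBddSymbol a) (f g : L2) :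
    inner ℂ (mulOp a ha f) g = ∫ x, (starRingEnd ℂ) (a x) * ((starRingEnd ℂ) (f x) * g x) := by
  rw [L2.inner_def]
  apply integral_congr_ae
  filter_upwards [coeFn_mulOp ha f] with x hx
  rw [hx, RCLike.inner_apply, map_mul]
  ring

theorem mulOp_mem_skewAdjoint {a : ℝ → ℂ} (ha : IsBddSymbol a)
    (hskew : ∀ x, (starRingEnd ℂ) (a x) = -a x) :
    mulOp a ha ∈ skewAdjoint (L2 →L[ℂ] L2) := by
  rw [skewAdjoint.mem_iff, ContinuousLinearMap.star_eq_adjoint]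
  symm
  rw [ContinuousLinearMap.eq_adjoint_iff]
  intro f g
  rw [neg_apply, inner_neg_left, inner_mulOp_left, L2.inner_def,
    ← integral_neg]
  apply integral_congr_ae
  filter_upwards [coeFn_mulOp ha g] with x hx
  rw [hx, RCLike.inner_apply, hskew]
  ring

/-! ### Weighted convolution on L² -/

open scoped ENNReal

theorem lintegral_mul_sq_le {X : Type*} [MeasurableSpace X] (μ : Measure X) {f g : X → ℝ≥0∞}
    (hf : AEMeasurable f μ) (hg : AEMeasurable g μ) :
    (∫⁻ x, f x * g x ∂μ) ^ 2 ≤ (∫⁻ x, f x ^ 2 ∂μ) * ∫⁻ x, g x ^ 2 ∂μ := by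
  have h := ENNReal.lintegral_mul_le_Lp_mul_Lq μ Real.HolderConjugate.two_two hf hg
  have h2 := pow_le_pow_left' h 2
  simp only [Pi.mul_apply, ENNReal.rpow_two, one_div] at h2
  refine h2.trans_eq ?_
  rw [mul_pow, ← ENNReal.rpow_natCast, ← ENNReal.rpow_natCast, ← ENNReal.rpow_mul,
    ← ENNReal.rpow_mul]
  norm_num

theorem lintegral_enorm_sq (f : ℝ → ℂ) :
    ∫⁻ x, ‖f x‖ₑ ^ 2 = eLpNorm f 2 volume ^ 2 := by
  have h := eLpNorm_nnreal_pow_eq_lintegral (f := f) (μ := (volume : Measure ℝ)) (p := 2)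
    (by norm_num)
  simp only [NNReal.coe_ofNat, ENNReal.rpow_two] at h
  exact h.symm

theorem lintegral_enorm_sq_coeFn (g : L2) : ∫⁻ x, ‖g x‖ₑ ^ 2 = ENNReal.ofReal (‖g‖ ^ 2) := by
  rw [lintegral_enorm_sq, Lp.norm_def, ← ENNReal.toReal_pow, ENNReal.ofReal_toReal]
  exact ENNReal.pow_ne_top (Lp.memLp g).2.ne

theorem memLp_of_lintegral_enorm_sq_le {f : ℝ → ℂ} (hf : AEStronglyMeasurable f volume) {K : ℝ}
    (h : ∫⁻ x, ‖f x‖ₑ ^ 2 ≤ ENNReal.ofReal (K ^ 2)) : MemLp f 2 volume := by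
  refine ⟨hf, ?_⟩
  rw [lintegral_enorm_sq] at h
  by_contra hc
  rw [not_lt, top_le_iff] at hc
  rw [hc] at h
  simp at h

theorem norm_toLp_le_of_lintegral_enorm_sq_le {f : ℝ → ℂ} (hf : MemLp f 2 volume) {K : ℝ}
    (hK : 0 ≤ K) (h : ∫⁻ x, ‖f x‖ₑ ^ 2 ≤ ENNReal.ofReal (K ^ 2)) :
    ‖(hf.toLp f : L2)‖ ≤ K := by
  rw [lintegral_enorm_sq] at h
  rw [Lp.norm_toLp]
  apply le_of_sq_le_sq _ hK
  rw [← ENNReal.toReal_pow]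
  exact ENNReal.toReal_le_of_le_ofReal (by positivity) h

/-- A weight for which the weighted convolution is bounded on `L²`. -/
structure IsConvWeight (W : ℝ → ℝ) (C : ℝ) : Prop where
  meas : Measurable W
  one_le : ∀ x, 1 ≤ W x
  nonneg : 0 ≤ C
  bound : ∀ x, ∫⁻ y, ENNReal.ofReal ((W x / (W y * W (x - y))) ^ 2) ≤ ENNReal.ofReal (C ^ 2)

section

variable {W : ℝ → ℝ} {C : ℝ}

theorem IsConvWeight.pos (hW : IsConvWeight W C) (x : ℝ) : 0 < W x :=
  zero_lt_one.trans_le (hW.one_le x)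

theorem IsConvWeight.symbol_inv (hW : IsConvWeight W C) :
    IsBddSymbol (fun x => ((W x)⁻¹ : ℝ)) where
  meas := Complex.measurable_ofReal.comp hW.meas.inv
  bdd := ⟨1, zero_le_one, fun x => by
    rw [Complex.norm_real, Real.norm_of_nonneg (inv_nonneg.2 (hW.pos x).le)]
    exact inv_le_one_of_one_le₀ (hW.one_le x)⟩

theorem IsConvWeight.memLp_inv_mul (hW : IsConvWeight W C) (g : L2) :
    MemLp (fun x => ((W x)⁻¹ : ℝ) * g x) 2 volume := by
  simpa using hW.symbol_inv.memLp (Lp.memLp g)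

theorem memLp_comp_sub_left {f : ℝ → ℂ} (hf : MemLp f 2 volume) (x : ℝ) :
    MemLp (fun y => f (x - y)) 2 volume :=
  hf.comp_measurePreserving (Measure.measurePreserving_sub_left volume x)

/-- The weighted convolution `W · ((g / W) * (h / W))`. -/
noncomputable def weightedConv (W : ℝ → ℝ) (g h : ℝ → ℂ) (x : ℝ) : ℂ :=
  W x * ∫ y, ((W y)⁻¹ : ℝ) * g y * (((W (x - y))⁻¹ : ℝ) * h (x - y))

theorem IsConvWeight.integrable_conv (hW : IsConvWeight W C) (g h : L2) (x : ℝ) :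
    Integrable fun y => ((W y)⁻¹ : ℝ) * g y * (((W (x - y))⁻¹ : ℝ) * h (x - y)) :=
  (hW.memLp_inv_mul g).integrable_mul (memLp_comp_sub_left (hW.memLp_inv_mul h) x)

theorem weightedConv_congr {g g' h h' : ℝ → ℂ} (hg : g =ᵐ[volume] g') (hh : h =ᵐ[volume] h') :
    weightedConv W g h = weightedConv W g' h' := by
  ext x
  unfold weightedConv
  congr 1
  apply integral_congr_ae
  filter_upwards [hg, (Measure.measurePreserving_sub_left volume x).quasiMeasurePreserving.ae_eq_comp hh]
    with y h1 h2
  simp only [Function.comp] at h2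
  rw [h1, h2]

theorem IsConvWeight.aestronglyMeasurable_weightedConv (hW : IsConvWeight W C) (g h : L2) :
    AEStronglyMeasurable (weightedConv W g h) volume := by
  apply AEStronglyMeasurable.mul
  · exact (Complex.measurable_ofReal.comp hW.meas).aestronglyMeasurable
  · exact ((hW.memLp_inv_mul g).1.convolution_integrand (ContinuousLinearMap.mul ℂ ℂ)
      (hW.memLp_inv_mul h).1).integral_prod_right'

theorem lintegral_lintegral_sq_mul_sq (g h : L2) :
    ∫⁻ x, ∫⁻ y, (‖g y‖ₑ * ‖h (x - y)‖ₑ) ^ 2 = ENNReal.ofReal ((‖g‖ * ‖h‖) ^ 2) := by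
  have hm : AEMeasurable (Function.uncurry fun x y : ℝ => (‖g y‖ₑ * ‖h (x - y)‖ₑ) ^ 2)
      (volume.prod volume) := by
    have := ((Lp.memLp g).1.convolution_integrand (ContinuousLinearMap.mul ℂ ℂ)
      (Lp.memLp h).1).enorm.pow_const 2
    refine this.congr (Eventually.of_forall fun p => ?_)
    simp [Function.uncurry, enorm_mul]
  rw [lintegral_lintegral_swap hm]
  have : ∀ y, ∫⁻ x, (‖g y‖ₑ * ‖h (x - y)‖ₑ) ^ 2 = ‖g y‖ₑ ^ 2 * ENNReal.ofReal (‖h‖ ^ 2) := by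
    intro y
    simp_rw [mul_pow]
    rw [lintegral_const_mul', lintegral_sub_right_eq_self (fun x => ‖h x‖ₑ ^ 2) y,
      lintegral_enorm_sq_coeFn]
    exact ENNReal.pow_ne_top enorm_ne_top
  simp_rw [this]
  rw [lintegral_mul_const' _ _ ENNReal.ofReal_ne_top, lintegral_enorm_sq_coeFn,
    ← ENNReal.ofReal_mul (by positivity), mul_pow]

theorem IsConvWeight.lintegral_weightedConv_sq_le (hW : IsConvWeight W C) (g h : L2) :
    ∫⁻ x, ‖weightedConv W g h x‖ₑ ^ 2 ≤ ENNReal.ofReal ((C * ‖g‖ * ‖h‖) ^ 2) := by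
  -- Cauchy–Schwarz in y isolates the weight quotient, whose square has integral at most C². The
  -- double integral of what remains factors as ‖g‖²‖h‖².
  have key : ∀ x, ‖weightedConv W g h x‖ₑ ^ 2 ≤
      ENNReal.ofReal (C ^ 2) * ∫⁻ y, (‖g y‖ₑ * ‖h (x - y)‖ₑ) ^ 2 := by
    intro x
    have h1 : ‖weightedConv W g h x‖ₑ ≤
        ∫⁻ y, ENNReal.ofReal (W x / (W y * W (x - y))) * (‖g y‖ₑ * ‖h (x - y)‖ₑ) := by
      unfold weightedConv
      rw [← integral_const_mul]
      refine (enorm_integral_le_lintegral_enorm _).trans (lintegral_mono fun y => le_of_eq ?_)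
      have hp : ∀ z, ‖((W z : ℝ) : ℂ)‖ₑ = ENNReal.ofReal (W z) := fun z => by
        rw [← ofReal_norm, Complex.norm_real, Real.norm_of_nonneg (hW.pos z).le]
      have hp' : ∀ z, ‖(((W z)⁻¹ : ℝ) : ℂ)‖ₑ = ENNReal.ofReal ((W z)⁻¹) := fun z => by
        rw [← ofReal_norm, Complex.norm_real,
          Real.norm_of_nonneg (inv_nonneg.2 (hW.pos z).le)]
      simp only [enorm_mul, hp, hp']
      rw [div_eq_mul_inv, mul_inv, ENNReal.ofReal_mul (hW.pos x).le,
        ENNReal.ofReal_mul (inv_nonneg.2 (hW.pos y).le)]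
      ring
    refine (pow_le_pow_left' h1 2).trans ((lintegral_mul_sq_le _ ?_ ?_).trans ?_)
    · have := hW.meas
      exact (by fun_prop : Measurable fun y => ENNReal.ofReal (W x / (W y * W (x - y)))).aemeasurable
    · exact (Lp.memLp g).1.enorm.mul (memLp_comp_sub_left (Lp.memLp h) x).1.enorm
    · gcongr
      refine le_trans (le_of_eq (lintegral_congr fun y => ?_)) (hW.bound x)
      rw [ENNReal.ofReal_pow]
      have := hW.pos x; have := hW.pos y; have := hW.pos (x - y)
      positivity
  refine (lintegral_mono key).trans ?_
  rw [lintegral_const_mul' _ _ ENNReal.ofReal_ne_top, lintegral_lintegral_sq_mul_sq,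
    ← ENNReal.ofReal_mul (by positivity)]
  apply le_of_eq
  ring_nf

theorem IsConvWeight.memLp_weightedConv (hW : IsConvWeight W C) (g h : L2) :
    MemLp (weightedConv W g h) 2 volume :=
  memLp_of_lintegral_enorm_sq_le (hW.aestronglyMeasurable_weightedConv g h)
    (hW.lintegral_weightedConv_sq_le g h)

/-- The weighted convolution as a bounded bilinear map on `L²`. -/
noncomputable def convOp (W : ℝ → ℝ) {C : ℝ} (hW : IsConvWeight W C) : L2 →L[ℂ] L2 →L[ℂ] L2 :=
  LinearMap.mkContinuous₂
    (LinearMap.mk₂ ℂ (fun g h => (hW.memLp_weightedConv g h).toLp _)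
      (fun g g' h => by
        rw [← MemLp.toLp_add]
        apply MemLp.toLp_congr
        rw [weightedConv_congr (Lp.coeFn_add g g') (ae_eq_refl _)]
        refine Eventually.of_forall fun x => ?_
        simp only [weightedConv, Pi.add_apply]
        rw [← mul_add, ← integral_add (hW.integrable_conv g h x) (hW.integrable_conv g' h x)]
        simp only [mul_add, add_mul])
      (fun c g h => by
        rw [← MemLp.toLp_const_smul]
        apply MemLp.toLp_congr
        rw [weightedConv_congr (Lp.coeFn_smul c g) (ae_eq_refl _)]
        refine Eventually.of_forall fun x => ?_
        simp only [weightedConv, Pi.smul_apply, smul_eq_mul]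
        rw [mul_left_comm c, ← integral_const_mul c]
        congr 1
        exact integral_congr_ae (Eventually.of_forall fun y => by dsimp only; ring))
      (fun g h h' => by
        rw [← MemLp.toLp_add]
        apply MemLp.toLp_congr
        rw [weightedConv_congr (ae_eq_refl _) (Lp.coeFn_add h h')]
        refine Eventually.of_forall fun x => ?_
        simp only [weightedConv, Pi.add_apply]
        rw [← mul_add, ← integral_add (hW.integrable_conv g h x) (hW.integrable_conv g h' x)]
        simp only [mul_add])
      (fun c g h => by
        rw [← MemLp.toLp_const_smul]
        apply MemLp.toLp_congr
        rw [weightedConv_congr (ae_eq_refl _) (Lp.coeFn_smul c h)]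
        refine Eventually.of_forall fun x => ?_
        simp only [weightedConv, Pi.smul_apply, smul_eq_mul]
        rw [mul_left_comm c, ← integral_const_mul c]
        congr 1
        exact integral_congr_ae (Eventually.of_forall fun y => by dsimp only; ring)))
    C
    (fun g h => norm_toLp_le_of_lintegral_enorm_sq_le (hW.memLp_weightedConv g h)
      (by have := hW.nonneg; positivity) (hW.lintegral_weightedConv_sq_le g h))

theorem coeFn_convOp (hW : IsConvWeight W C) (g h : L2) :
    convOp W hW g h =ᵐ[volume] weightedConv W g h :=
  (hW.memLp_weightedConv g h).coeFn_toLp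

theorem norm_convOp_le (hW : IsConvWeight W C) (g h : L2) :
    ‖convOp W hW g h‖ ≤ C * ‖g‖ * ‖h‖ :=
  norm_toLp_le_of_lintegral_enorm_sq_le (hW.memLp_weightedConv g h)
    (by have := hW.nonneg; positivity) (hW.lintegral_weightedConv_sq_le g h)

theorem conjNeg_convOp (hW : IsConvWeight W C) (heven : ∀ x, W (-x) = W x) (g h : L2) :
    conjNeg (convOp W hW g h) = convOp W hW (conjNeg g) (conjNeg h) := by
  apply Lp.ext
  filter_upwards [coeFn_conjNeg (convOp W hW g h),
    measurePreserving_neg_real.quasiMeasurePreserving.ae_eq_comp (coeFn_convOp hW g h),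
    coeFn_convOp hW (conjNeg g) (conjNeg h)] with x e1 e2 e3
  simp only [Function.comp] at e2
  rw [e1, e2, e3, weightedConv_congr (coeFn_conjNeg g) (coeFn_conjNeg h)]
  simp only [weightedConv, map_mul, Complex.conj_ofReal, heven]
  rw [← integral_conj, ← integral_neg_eq_self]
  congr 2
  ext y
  simp only [map_mul, Complex.conj_ofReal, heven]
  have : -x - -y = -(x - y) := by ring
  rw [this, heven]

end

/-! ### The weights and their algebra property, uniform in σ -/

/-- The weight `1 + |ξ|` in the variable `η = ξ / 2π`. -/
noncomputable def jap (η : ℝ) : ℝ := 1 + |2 * Real.pi * η|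

/-- The symbol `cosh (σ ξ)` in the variable `η = ξ / 2π`. -/
noncomputable def coshSymbol (σ η : ℝ) : ℝ := Real.cosh (σ * (2 * Real.pi * η))

/-- The weight of the norm `‖I f‖_{H^{α/2}}`. -/
noncomputable def weight (α σ η : ℝ) : ℝ := jap η ^ (α / 2) * coshSymbol σ η

theorem one_le_jap (η : ℝ) : 1 ≤ jap η := by simp [jap]

theorem jap_pos (η : ℝ) : 0 < jap η := zero_lt_one.trans_le (one_le_jap η)

theorem continuous_jap : Continuous jap := by unfold jap; fun_prop

theorem continuous_coshSymbol (σ : ℝ) : Continuous (coshSymbol σ) := by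
  unfold coshSymbol; fun_prop

theorem jap_neg (η : ℝ) : jap (-η) = jap η := by simp [jap]

theorem coshSymbol_neg (σ η : ℝ) : coshSymbol σ (-η) = coshSymbol σ η := by
  simp [coshSymbol]

theorem weight_neg (α σ η : ℝ) : weight α σ (-η) = weight α σ η := by
  simp [weight, jap_neg, coshSymbol_neg]

theorem jap_le_add (x y : ℝ) : jap x ≤ jap y + jap (x - y) := by
  have : |2 * Real.pi * x| ≤ |2 * Real.pi * y| + |2 * Real.pi * (x - y)| := by
    refine (congrArg abs ?_).le.trans (abs_add_le _ _)
    ring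
  unfold jap
  linarith

theorem one_le_coshSymbol (σ η : ℝ) : 1 ≤ coshSymbol σ η := Real.one_le_cosh _

theorem coshSymbol_pos (σ η : ℝ) : 0 < coshSymbol σ η := Real.cosh_pos _

theorem abs_sinh_le_cosh (x : ℝ) : |Real.sinh x| ≤ Real.cosh x := by
  refine abs_le.2 ⟨?_, Real.sinh_lt_cosh x |>.le⟩
  have := (Real.sinh_lt_cosh (-x)).le
  rw [Real.sinh_neg, Real.cosh_neg] at this
  linarith

/-- Addition formula and |sinh| ≤ cosh. The factor 2 is free of σ, and so are all the constants
built on it. -/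
theorem coshSymbol_le (σ x y : ℝ) : coshSymbol σ x ≤ 2 * (coshSymbol σ y * coshSymbol σ (x - y)) := by
  unfold coshSymbol
  have e : σ * (2 * Real.pi * x) = σ * (2 * Real.pi * y) + σ * (2 * Real.pi * (x - y)) := by ring
  rw [e, Real.cosh_add]
  set a := σ * (2 * Real.pi * y)
  set b := σ * (2 * Real.pi * (x - y))
  have h : Real.sinh a * Real.sinh b ≤ Real.cosh a * Real.cosh b :=
    (le_abs_self _).trans (by
      rw [abs_mul]
      exact mul_le_mul (abs_sinh_le_cosh a) (abs_sinh_le_cosh b) (abs_nonneg _)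
        (Real.cosh_pos _).le)
  linarith

theorem jap_rpow_le {s : ℝ} (hs : 0 ≤ s) (x y : ℝ) :
    jap x ^ s ≤ 2 ^ s * (jap y ^ s + jap (x - y) ^ s) := by
  have hy := (jap_pos y).le
  have hz := (jap_pos (x - y)).le
  have h1 : jap x ≤ 2 * max (jap y) (jap (x - y)) := by
    have := jap_le_add x y
    have := le_max_left (jap y) (jap (x - y))
    have := le_max_right (jap y) (jap (x - y))
    linarith
  refine (Real.rpow_le_rpow (jap_pos x).le h1 hs).trans ?_
  rw [Real.mul_rpow (by norm_num) (le_max_of_le_left hy)]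
  gcongr
  rcases max_cases (jap y) (jap (x - y)) with ⟨h, -⟩ | ⟨h, -⟩ <;> rw [h]
  · linarith [Real.rpow_nonneg hz s]
  · linarith [Real.rpow_nonneg hy s]

theorem integrable_jap_rpow {α : ℝ} (hα : 1 < α) : Integrable fun η => jap η ^ (-α) := by
  have h := integrable_one_add_norm (E := ℝ) (μ := volume) (r := α) (by simpa using hα)
  have h2 := h.comp_mul_left' (R := 2 * Real.pi) (by positivity)
  simpa [jap] using h2

theorem continuous_jap_rpow (s : ℝ) : Continuous fun η => jap η ^ s :=
  continuous_jap.rpow_const fun η => Or.inl (jap_pos η).ne'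

theorem continuous_weight (α σ : ℝ) : Continuous (weight α σ) :=
  (continuous_jap_rpow _).mul (continuous_coshSymbol σ)

theorem one_le_weight {α : ℝ} (hα : 0 ≤ α) (σ η : ℝ) : 1 ≤ weight α σ η :=
  one_le_mul_of_one_le_of_one_le (Real.one_le_rpow (one_le_jap η) (by linarith))
    (one_le_coshSymbol σ η)

theorem weight_pos (α σ η : ℝ) : 0 < weight α σ η :=
  mul_pos (Real.rpow_pos_of_pos (jap_pos η) _) (coshSymbol_pos σ η)

/-- One of the two frequencies y, x - y carries at least half of the polynomial weight of x, so the
weight of the other survives in the denominator. The hyperbolic factors cancel up to 2. -/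
theorem weight_div_sq_le {α : ℝ} (hα : 0 ≤ α) (σ x y : ℝ) :
    (weight α σ x / (weight α σ y * weight α σ (x - y))) ^ 2 ≤
      8 * (2 ^ (α / 2)) ^ 2 * (jap y ^ (-α) + jap (x - y) ^ (-α)) := by
  have hJ : ∀ z, jap z ^ (-α) = ((jap z ^ (α / 2))⁻¹) ^ 2 := fun z => by
    rw [← Real.rpow_neg (jap_pos z).le, ← Real.rpow_natCast, ← Real.rpow_mul (jap_pos z).le]
    congr 1; push_cast; ring
  have hj := jap_rpow_le (s := α / 2) (by linarith) x y
  have hc := coshSymbol_le σ x y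
  have h1 : weight α σ x / (weight α σ y * weight α σ (x - y)) ≤
      2 * 2 ^ (α / 2) * ((jap y ^ (α / 2))⁻¹ + (jap (x - y) ^ (α / 2))⁻¹) := by
    rw [div_le_iff₀ (mul_pos (weight_pos _ _ _) (weight_pos _ _ _))]
    unfold weight
    have py : 0 < jap y ^ (α / 2) := Real.rpow_pos_of_pos (jap_pos y) _
    have pz : 0 < jap (x - y) ^ (α / 2) := Real.rpow_pos_of_pos (jap_pos _) _
    have := mul_le_mul hj hc (coshSymbol_pos σ x).le (by positivity)
    refine this.trans (le_of_eq ?_)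
    field_simp
    ring
  have h0 : 0 ≤ weight α σ x / (weight α σ y * weight α σ (x - y)) := by
    have := weight_pos α σ x; have := weight_pos α σ y; have := weight_pos α σ (x - y)
    positivity
  refine (pow_le_pow_left₀ h0 h1 2).trans ?_
  rw [hJ, hJ, mul_pow, mul_pow]
  have := add_sq_le (a := (jap y ^ (α / 2))⁻¹) (b := (jap (x - y) ^ (α / 2))⁻¹)
  have p : 0 ≤ (2 ^ (α / 2) : ℝ) ^ 2 := by positivity
  nlinarith

/-- The weights are convolution weights with a constant that does not depend on `σ`. -/
theorem exists_isConvWeight {α : ℝ} (hα : 1 < α) :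
    ∃ C, 0 < C ∧ ∀ σ, IsConvWeight (weight α σ) C := by
  set J := ∫ η, jap η ^ (-α) with hJ
  have hpos : ∀ η, 0 < jap η ^ (-α) := fun η => Real.rpow_pos_of_pos (jap_pos η) _
  have hJ0 : 0 ≤ J := integral_nonneg fun η => (hpos η).le
  set K : ℝ := 8 * (2 ^ (α / 2)) ^ 2 with hK
  have hK0 : 0 < K := by positivity
  -- The two copies of J come from the terms in y and in x - y; the `+ 1` only makes the constant
  -- positive.
  refine ⟨Real.sqrt (K * (J + J)) + 1, by positivity, fun σ =>
    ⟨(continuous_weight α σ).measurable, one_le_weight (by linarith) σ, by positivity,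
      fun x => ?_⟩⟩
  have hi := integrable_jap_rpow hα
  have hi2 : Integrable fun y => jap (x - y) ^ (-α) := hi.comp_sub_left x
  calc ∫⁻ y, ENNReal.ofReal ((weight α σ x / (weight α σ y * weight α σ (x - y))) ^ 2)
      ≤ ∫⁻ y, ENNReal.ofReal (K * (jap y ^ (-α) + jap (x - y) ^ (-α))) :=
        lintegral_mono fun y => ENNReal.ofReal_le_ofReal (weight_div_sq_le (by linarith) σ x y)
    _ = ENNReal.ofReal (∫ y, K * (jap y ^ (-α) + jap (x - y) ^ (-α))) := by
        refine (ofReal_integral_eq_lintegral_ofReal ((hi.add hi2).const_mul K) ?_).symm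
        refine Eventually.of_forall fun y => ?_
        exact mul_nonneg hK0.le (add_pos (hpos y) (hpos (x - y))).le
    _ = ENNReal.ofReal (K * (J + J)) := by
        rw [integral_const_mul, integral_add hi hi2,
          integral_sub_left_eq_self (fun y => jap y ^ (-α)) volume x]
    _ ≤ _ := by
        apply ENNReal.ofReal_le_ofReal
        have h := Real.sq_sqrt (by positivity : 0 ≤ K * (J + J))
        have := Real.sqrt_nonneg (K * (J + J))
        nlinarith

/-! ### Quadratic differential equations: uniqueness and regularity -/

section ODE

variable {E : Type*} [NormedAddCommGroup E] [NormedSpace ℂ E]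

/-- From Q(x,x) - Q(y,y) = Q(x, x-y) + Q(x-y, y), which needs no symmetry of Q. -/
theorem norm_quadratic_sub_le {Q : E →L[ℂ] E →L[ℂ] E} {C : ℝ}
    (hQ : ∀ x y, ‖Q x y‖ ≤ C * ‖x‖ * ‖y‖) {M : ℝ} (hC : 0 ≤ C) {x y : E} (hx : ‖x‖ ≤ M)
    (hy : ‖y‖ ≤ M) : ‖Q x x - Q y y‖ ≤ 2 * C * M * ‖x - y‖ := by
  have e : Q x x - Q y y = Q x (x - y) + Q (x - y) y := by
    rw [map_sub, map_sub, sub_apply]; abel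
  rw [e]
  refine (norm_add_le _ _).trans ((add_le_add (hQ _ _) (hQ _ _)).trans ?_)
  have h1 : C * ‖x‖ * ‖x - y‖ ≤ C * M * ‖x - y‖ := by gcongr
  have h2 : C * ‖x - y‖ * ‖y‖ ≤ C * ‖x - y‖ * M := by gcongr
  linarith

theorem hasDerivWithinAt_Ici_of_Icc {δ t : ℝ} (ht : t ∈ Ico 0 δ) {f : ℝ → E} {f' : E}
    (h : HasDerivWithinAt f f' (Icc 0 δ) t) : HasDerivWithinAt f f' (Ici t) t :=
  h.mono_of_mem_nhdsWithin (Icc_mem_nhdsGE_of_mem ht)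

/-- Uniqueness for a quadratic ordinary differential equation. -/
theorem eqOn_of_hasDerivWithinAt_quadratic (A : E →L[ℂ] E) {Q : E →L[ℂ] E →L[ℂ] E} {C : ℝ}
    (hC : 0 ≤ C) (hQ : ∀ x y, ‖Q x y‖ ≤ C * ‖x‖ * ‖y‖) {δ : ℝ} {g h : ℝ → E}
    (hg : ∀ t ∈ Icc 0 δ, HasDerivWithinAt g (A (g t) + Q (g t) (g t)) (Icc 0 δ) t)
    (hh : ∀ t ∈ Icc 0 δ, HasDerivWithinAt h (A (h t) + Q (h t) (h t)) (Icc 0 δ) t)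
    (h0 : g 0 = h 0) : EqOn g h (Icc 0 δ) := by
  have cg : ContinuousOn g (Icc 0 δ) := fun t ht => (hg t ht).continuousWithinAt
  have ch : ContinuousOn h (Icc 0 δ) := fun t ht => (hh t ht).continuousWithinAt
  -- The field is only locally Lipschitz; boundedness of both curves on the compact interval
  -- supplies the Grönwall constant.
  obtain ⟨M₁, hM₁⟩ := isCompact_Icc.exists_bound_of_continuousOn cg
  obtain ⟨M₂, hM₂⟩ := isCompact_Icc.exists_bound_of_continuousOn ch
  have key := eq_zero_of_abs_deriv_le_mul_abs_self_of_eq_zero_right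
    (f := fun t => g t - h t)
    (f' := fun t => (A (g t) + Q (g t) (g t)) - (A (h t) + Q (h t) (h t)))
    (K := ‖A‖ + 2 * C * max M₁ M₂) (a := 0) (b := δ) (cg.sub ch)
    (fun t ht => (hasDerivWithinAt_Ici_of_Icc ht (hg t (Ico_subset_Icc_self ht))).sub
      (hasDerivWithinAt_Ici_of_Icc ht (hh t (Ico_subset_Icc_self ht))))
    (by simp [h0])
    (fun t ht => by
      have ht' := Ico_subset_Icc_self ht
      have e : (A (g t) + Q (g t) (g t)) - (A (h t) + Q (h t) (h t)) =
          A (g t - h t) + (Q (g t) (g t) - Q (h t) (h t)) := by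
        rw [map_sub]; abel
      rw [e, add_mul]
      exact (norm_add_le _ _).trans (add_le_add (A.le_opNorm _)
        (norm_quadratic_sub_le hQ hC ((hM₁ t ht').trans (le_max_left _ _))
          ((hM₂ t ht').trans (le_max_right _ _)))))
  exact fun t ht => sub_eq_zero.1 (key t ht)

/-- If the image of a continuous curve under an injective operator is differentiable with
derivative the image of a continuous curve, then the curve itself is differentiable. -/
theorem hasDerivWithinAt_of_injective [CompleteSpace E] {E' : Type*} [NormedAddCommGroup E']
    [NormedSpace ℂ E'] (T : E →L[ℂ] E') (hT : Function.Injective T) {δ : ℝ} {g k : ℝ → E}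
    (hg : ContinuousOn g (Icc 0 δ)) (hk : ContinuousOn k (Icc 0 δ))
    (h : ∀ t ∈ Icc 0 δ, HasDerivWithinAt (fun t => T (g t)) (T (k t)) (Icc 0 δ) t) :
    ∀ t ∈ Icc 0 δ, HasDerivWithinAt g (k t) (Icc 0 δ) t := by
  intro t₁ ht₁
  have h0 : (0 : ℝ) ∈ Icc 0 δ := ⟨le_rfl, ht₁.1.trans ht₁.2⟩
  -- G is the primitive of k starting at g(0). T∘G and T∘g have equal derivatives and initial
  -- values, so injectivity of T gives g = G.
  set G : ℝ → E := ODE.picard (fun t _ => k t) 0 (g 0) g with hG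
  have hGd : ∀ t ∈ Icc 0 δ, HasDerivWithinAt G (k t) (Icc 0 δ) t := fun t ht =>
    ODE.hasDerivWithinAt_picard_Icc (u := univ) (f := fun t _ => k t) h0
      (hk.comp continuousOn_fst fun p hp => hp.1) hg (fun _ _ => mem_univ _) (g 0) ht
  have hTG : ∀ t ∈ Icc 0 δ, HasDerivWithinAt (fun t => T (G t)) (T (k t)) (Icc 0 δ) t :=
    fun t ht => (T.restrictScalars ℝ).hasFDerivAt.comp_hasDerivWithinAt t (hGd t ht)
  have key := eq_zero_of_abs_deriv_le_mul_abs_self_of_eq_zero_right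
    (f := fun t => T (G t) - T (g t)) (f' := fun t => T (k t) - T (k t)) (K := 0) (a := 0) (b := δ)
    (fun t ht => ((hTG t ht).sub (h t ht)).continuousWithinAt)
    (fun t ht => (hasDerivWithinAt_Ici_of_Icc ht (hTG t (Ico_subset_Icc_self ht))).sub
      (hasDerivWithinAt_Ici_of_Icc ht (h t (Ico_subset_Icc_self ht))))
    (by simp [hG]) (fun t ht => by simp)
  have e : EqOn g G (Icc 0 δ) := fun t ht => (hT (sub_eq_zero.1 (key t ht))).symm
  exact (hGd t₁ ht₁).congr e (e ht₁)

end ODE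

/-! ### Existence through the unitary group of the linear part -/

section Existence

variable {E : Type*} [NormedAddCommGroup E] [InnerProductSpace ℂ E] [CompleteSpace E]

theorem exp_smul_mem_unitary {𝔸 : Type*} [NormedRing 𝔸] [NormedAlgebra ℂ 𝔸] [StarRing 𝔸]
    [ContinuousStar 𝔸] [CompleteSpace 𝔸] [StarModule ℂ 𝔸] {a : 𝔸} (ha : a ∈ skewAdjoint 𝔸)
    (t : ℝ) : NormedSpace.exp (t • a) ∈ unitary 𝔸 :=
  let +nondep : NormedAlgebra ℚ 𝔸 := .restrictScalars ℚ ℂ 𝔸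
  NormedSpace.exp_mem_unitary_of_mem_skewAdjoint (skewAdjoint.smul_mem t ha)

theorem exp_smul_mul_exp_neg_smul {𝔸 : Type*} [NormedRing 𝔸] [NormedAlgebra ℂ 𝔸]
    [CompleteSpace 𝔸] (a : 𝔸) (t : ℝ) :
    NormedSpace.exp (t • a) * NormedSpace.exp ((-t) • a) = 1 := by
  let +nondep : NormedAlgebra ℚ 𝔸 := .restrictScalars ℚ ℂ 𝔸
  rw [← NormedSpace.exp_add_of_commute (((Commute.refl a).smul_left t).smul_right (-t))]
  simp

theorem norm_exp_smul_apply {A : E →L[ℂ] E} (hA : A ∈ skewAdjoint (E →L[ℂ] E)) (t : ℝ) (x : E) :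
    ‖NormedSpace.exp (t • A) x‖ = ‖x‖ :=
  ContinuousLinearMap.norm_map_of_mem_unitary (exp_smul_mem_unitary hA t) x

theorem exp_smul_exp_neg_smul_apply (A : E →L[ℂ] E) (t : ℝ) (x : E) :
    NormedSpace.exp (t • A) (NormedSpace.exp ((-t) • A) x) = x := by
  rw [← mul_apply_eq_comp, exp_smul_mul_exp_neg_smul, one_apply_eq_self]

theorem continuous_exp_smul_apply (A : E →L[ℂ] E) (x : E) :
    Continuous fun t : ℝ => NormedSpace.exp (t • A) x := by
  have h1 : Continuous fun t : ℝ => NormedSpace.exp (t • A) :=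
    continuous_iff_continuousAt.2 fun t => (hasDerivAt_exp_smul_const A t).continuousAt
  exact h1.clm_apply continuous_const

/-- Existence, on a time interval that does not depend on the linear part, for an equation with
skew-adjoint linear part and quadratic nonlinearity. -/
theorem exists_hasDerivWithinAt_quadratic {A : E →L[ℂ] E} (hA : A ∈ skewAdjoint (E →L[ℂ] E))
    {Q : E →L[ℂ] E →L[ℂ] E} {C : ℝ} (hC : 0 ≤ C) (hQ : ∀ x y, ‖Q x y‖ ≤ C * ‖x‖ * ‖y‖)
    (x₀ : E) {δ : ℝ} (hδ : 0 ≤ δ) (hsmall : 4 * C * (δ * ‖x₀‖) ≤ 1) :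
    ∃ g : ℝ → E, g 0 = x₀ ∧ (∀ t ∈ Icc 0 δ, ‖g t‖ ≤ 2 * ‖x₀‖) ∧
      ∀ t ∈ Icc 0 δ, HasDerivWithinAt g (A (g t) + Q (g t) (g t)) (Icc 0 δ) t := by
  set U : ℝ → E →L[ℂ] E := fun t => NormedSpace.exp (t • A) with hU
  have hUn : ∀ t x, ‖U t x‖ = ‖x‖ := norm_exp_smul_apply hA
  -- The field satisfied by h(t) = U(-t)g(t). As U is isometric, its size and Lipschitz constant
  -- involve Q alone.
  set f : ℝ → E → E := fun t x => U (-t) (Q (U t x) (U t x)) with hf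
  have hball : ∀ x ∈ Metric.closedBall x₀ (‖x₀‖₊ : ℝ), ‖x‖ ≤ 2 * ‖x₀‖ := fun x hx => by
    have h1 := mem_closedBall_iff_norm.1 hx
    have h2 := norm_sub_norm_le x x₀
    simp only [coe_nnnorm] at h1
    linarith
  have hR := norm_nonneg x₀
  -- On the ball of radius ‖x₀‖ about x₀ norms are at most 2‖x₀‖, so the field is at most C(2‖x₀‖)².
  -- The curve stays in the ball when 4C‖x₀‖²δ ≤ ‖x₀‖, which follows from the smallness assumption.
  have pl : IsPicardLindelof f (tmin := 0) (tmax := δ) ⟨0, le_rfl, hδ⟩ x₀ ‖x₀‖₊ 0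
      (Real.toNNReal (4 * C * ‖x₀‖ ^ 2)) (Real.toNNReal (2 * C * (2 * ‖x₀‖))) :=
    { lipschitzOnWith := fun t ht => LipschitzOnWith.of_dist_le_mul fun x hx y hy => by
        rw [Real.coe_toNNReal _ (by positivity), dist_eq_norm, dist_eq_norm]
        simp only [hf]
        rw [← map_sub, hUn]
        refine (norm_quadratic_sub_le hQ hC (M := 2 * ‖x₀‖) ?_ ?_).trans_eq ?_
        · rw [hUn]; exact hball x hx
        · rw [hUn]; exact hball y hy
        · rw [← map_sub, hUn]
      continuousOn := fun x hx => by
        apply Continuous.continuousOn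
        have h1 : Continuous fun t : ℝ => U t x := continuous_exp_smul_apply A x
        have h2 : Continuous fun t : ℝ => Q (U t x) (U t x) := by fun_prop
        have h3 : Continuous fun t : ℝ => U (-t) := by
          have : Continuous U :=
            continuous_iff_continuousAt.2 fun t => (hasDerivAt_exp_smul_const A t).continuousAt
          exact this.comp continuous_neg
        exact h3.clm_apply h2
      norm_le := fun t ht x hx => by
        rw [Real.coe_toNNReal _ (by positivity)]
        simp only [hf]
        rw [hUn]
        refine (hQ _ _).trans ?_
        rw [hUn]
        have := hball x hx
        have h2 : ‖x‖ * ‖x‖ ≤ (2 * ‖x₀‖) * (2 * ‖x₀‖) :=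
          mul_le_mul this this (norm_nonneg _) (by positivity)
        nlinarith
      mul_max_le := by
        rw [Real.coe_toNNReal _ (by positivity)]
        simp only [sub_zero, sub_self, coe_nnnorm, NNReal.coe_zero, max_eq_left hδ]
        nlinarith }
  obtain ⟨α, hα⟩ := ODE.FunSpace.exists_isFixedPt_next pl
    (x := x₀) (by simp)
  have hfix := (ODE.FunSpace.isFixedPt_next_iff pl (by simp)).1 hα
  set h : ℝ → E := α.compProj with hh
  have hmem : ∀ t, h t ∈ Metric.closedBall x₀ (‖x₀‖₊ : ℝ) := fun t =>
    α.compProj_mem_closedBall pl.mul_max_le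
  have heq : EqOn h (ODE.picard f 0 x₀ h) (Icc 0 δ) := fun t ht => by
    rw [hh, ODE.FunSpace.compProj_of_mem ht]; exact hfix ⟨t, ht⟩
  have hderiv : ∀ t ∈ Icc 0 δ, HasDerivWithinAt h (f t (h t)) (Icc 0 δ) t := fun t ht =>
    (ODE.hasDerivWithinAt_picard_Icc ⟨le_rfl, hδ⟩ pl.continuousOn_uncurry
      α.continuous_compProj.continuousOn (fun t _ => hmem t) x₀ ht).congr heq (heq ht)
  refine ⟨fun t => U t (h t), ?_, fun t ht => by rw [hUn]; exact hball _ (hmem t),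
    fun t ht => ?_⟩
  · have : h 0 = x₀ := by rw [heq ⟨le_rfl, hδ⟩, ODE.picard_apply₀]
    simp [this, hU]
  · have h1 : HasDerivAt U (A * U t) t := hasDerivAt_exp_smul_const' A t
    have h2 : HasDerivAt (fun t => (U t).restrictScalars ℝ) ((A * U t).restrictScalars ℝ) t :=
      (ContinuousLinearMap.restrictScalarsL ℂ E E ℝ ℝ).hasFDerivAt.comp_hasDerivAt t h1
    have h3 := h2.hasDerivWithinAt.clm_apply (hderiv t ht)
    refine h3.congr_deriv ?_
    simp only [hf, ContinuousLinearMap.coe_restrictScalars', mul_apply_eq_comp]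
    congr 1
    exact exp_smul_exp_neg_smul_apply A t _

end Existence

/-! ### Calculus of possibly unbounded multipliers -/

theorem mulOp_mulOp {a b c : ℝ → ℂ} (ha : IsBddSymbol a) (hb : IsBddSymbol b) (hc : IsBddSymbol c)
    (h : ∀ x, a x * b x = c x) (g : L2) : mulOp a ha (mulOp b hb g) = mulOp c hc g := by
  apply Lp.ext
  filter_upwards [coeFn_mulOp ha (mulOp b hb g), coeFn_mulOp hb g, coeFn_mulOp hc g]
    with x h1 h2 h3
  rw [h1, h2, h3, ← h, mul_assoc]

theorem mulOp_injective {a : ℝ → ℂ} (ha : IsBddSymbol a) (h0 : ∀ x, a x ≠ 0) :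
    Function.Injective (mulOp a ha) := by
  intro f g hfg
  apply Lp.ext
  have := coeFn_mulOp ha f
  rw [hfg] at this
  filter_upwards [this, coeFn_mulOp ha g] with x h1 h2
  exact mul_left_cancel₀ (h0 x) (h1.symm.trans h2)

/-- The symbol `a` may be unbounded as long as `b` tames it. Domain questions for I, D^s and ∂ₓ on
functions with Fourier transform g/W thus reduce to boundedness of a product. -/
theorem inDomain_fourierInv_mulOp {a b c : ℝ → ℂ} (hb : IsBddSymbol b) (hc : IsBddSymbol c)
    (h : ∀ η, a (2 * Real.pi * η) * b η = c η) (g : L2) :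
    InDomain a (𝓕⁻ (mulOp b hb g) : L2) := by
  unfold InDomain
  rw [FourierTransform.fourier_fourierInv_eq]
  refine (hc.memLp (Lp.memLp g)).ae_eq ?_
  filter_upwards [coeFn_mulOp hb g] with x hx
  rw [hx, ← h, mul_assoc]

theorem multiplier_fourierInv_mulOp {a b c : ℝ → ℂ} (hb : IsBddSymbol b) (hc : IsBddSymbol c)
    (h : ∀ η, a (2 * Real.pi * η) * b η = c η) (g : L2) :
    multiplier a (𝓕⁻ (mulOp b hb g) : L2) = 𝓕⁻ (mulOp c hc g) := by
  unfold multiplier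
  rw [dif_pos (inDomain_fourierInv_mulOp hb hc h g)]
  congr 1
  apply Lp.ext
  filter_upwards [(inDomain_fourierInv_mulOp hb hc h g).coeFn_toLp, coeFn_mulOp hb g,
    coeFn_mulOp hc g] with x h1 h2 h3
  rw [h1, h3, ← h, mul_assoc (a _), ← h2, FourierTransform.fourier_fourierInv_eq]

theorem coeFn_fourier_multiplier {a : ℝ → ℂ} {f : L2} (h : InDomain a f) :
    (𝓕 (multiplier a f) : L2) =ᵐ[volume] fun η => a (2 * Real.pi * η) * (𝓕 f : L2) η := by
  unfold multiplier
  rw [dif_pos h, FourierTransform.fourier_fourierInv_eq]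
  exact h.coeFn_toLp

theorem isBddSymbol_ofReal {r : ℝ → ℝ} (hr : Measurable r) (C : ℝ) (hC : 0 ≤ C)
    (h : ∀ x, |r x| ≤ C) : IsBddSymbol fun x => (r x : ℂ) where
  meas := Complex.measurable_ofReal.comp hr
  bdd := ⟨C, hC, fun x => by rw [Complex.norm_real]; exact h x⟩

theorem IsBddSymbol.mul {a b : ℝ → ℂ} (ha : IsBddSymbol a) (hb : IsBddSymbol b) :
    IsBddSymbol fun x => a x * b x where
  meas := ha.meas.mul hb.meas
  bdd := by
    obtain ⟨C, hC, h⟩ := ha.bdd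
    obtain ⟨D, hD, h'⟩ := hb.bdd
    exact ⟨C * D, mul_nonneg hC hD, fun x => by
      rw [norm_mul]; exact mul_le_mul (h x) (h' x) (norm_nonneg _) hC⟩

theorem IsBddSymbol.add {a b : ℝ → ℂ} (ha : IsBddSymbol a) (hb : IsBddSymbol b) :
    IsBddSymbol fun x => a x + b x where
  meas := ha.meas.add hb.meas
  bdd := by
    obtain ⟨C, hC, h⟩ := ha.bdd
    obtain ⟨D, hD, h'⟩ := hb.bdd
    exact ⟨C + D, add_nonneg hC hD, fun x => (norm_add_le _ _).trans (add_le_add (h x) (h' x))⟩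

theorem isBddSymbol_const (c : ℂ) : IsBddSymbol fun _ => c :=
  ⟨measurable_const, ‖c‖, norm_nonneg _, fun _ => le_rfl⟩

/-! ### Sobolev norms and Bessel potentials -/

section Sobolev

theorem one_add_abs_eq_jap (ξ : ℝ) : 1 + |ξ| = jap (ξ / (2 * Real.pi)) := by
  have : 2 * Real.pi ≠ 0 := by positivity
  unfold jap
  rw [mul_div_cancel₀ _ this]

theorem memHs_iff {s : ℝ} {f : L2} :
    MemHs s f ↔ Integrable fun η => jap η ^ (2 * s) * ‖(𝓕 f : L2) η‖ ^ 2 := by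
  have : 2 * Real.pi ≠ 0 := by positivity
  have h := integrable_comp_div_iff
    (fun η => jap η ^ (2 * s) * ‖(𝓕 f : L2) η‖ ^ 2) this
  unfold MemHs fhat
  simp_rw [one_add_abs_eq_jap]
  exact h

/-- The Jacobian of ξ = 2πη is the source of every √(2π) below. -/
theorem normHs_eq (s : ℝ) (f : L2) :
    normHs s f = Real.sqrt (2 * Real.pi * ∫ η, jap η ^ (2 * s) * ‖(𝓕 f : L2) η‖ ^ 2) := by
  unfold normHs fhat
  simp_rw [one_add_abs_eq_jap]
  rw [Measure.integral_comp_div (fun η => jap η ^ (2 * s) * ‖(𝓕 f : L2) η‖ ^ 2)]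
  rw [abs_of_pos (by positivity), smul_eq_mul]

theorem integral_norm_sq (g : L2) : ∫ x, ‖g x‖ ^ 2 = ‖g‖ ^ 2 := by
  have h := L2.inner_def (𝕜 := ℂ) g g
  rw [inner_self_eq_norm_sq_to_K] at h
  simp only [inner_self_eq_norm_sq_to_K] at h
  have : ((∫ x, ‖g x‖ ^ 2 : ℝ) : ℂ) = ((‖g‖ ^ 2 : ℝ) : ℂ) := by
    rw [← integral_complex_ofReal]
    push_cast
    exact h.symm
  exact_mod_cast this

theorem jap_rpow_sq (s η : ℝ) : jap η ^ (2 * s) = (jap η ^ s) ^ 2 := by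
  rw [← Real.rpow_natCast, ← Real.rpow_mul (jap_pos η).le, mul_comm]; norm_num

theorem isBddSymbol_jap {s : ℝ} (hs : 0 ≤ s) : IsBddSymbol fun η => ((jap η ^ (-s) : ℝ) : ℂ) :=
  isBddSymbol_ofReal (continuous_jap_rpow _).measurable 1 zero_le_one fun x => by
    rw [abs_of_pos (Real.rpow_pos_of_pos (jap_pos x) _)]
    exact Real.rpow_le_one_of_one_le_of_nonpos (one_le_jap x) (by linarith)

/-- The Bessel potential `g ↦ F⁻¹ ((1 + |ξ|)^{-s} g)`. -/
noncomputable def bessel (s : ℝ) (hs : 0 ≤ s) (g : L2) : L2 :=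
  𝓕⁻ (mulOp _ (isBddSymbol_jap hs) g)

theorem jap_mul_norm_fourier_bessel (s : ℝ) (hs : 0 ≤ s) (g : L2) :
    (fun η => jap η ^ (2 * s) * ‖(𝓕 (bessel s hs g) : L2) η‖ ^ 2) =ᵐ[volume]
      fun η => ‖g η‖ ^ 2 := by
  unfold bessel
  rw [FourierTransform.fourier_fourierInv_eq]
  filter_upwards [coeFn_mulOp (isBddSymbol_jap hs) g] with x hx
  have h0 := Real.rpow_pos_of_pos (jap_pos x) s
  rw [hx, norm_mul, Complex.norm_real, mul_pow, Real.norm_eq_abs, sq_abs, jap_rpow_sq,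
    Real.rpow_neg (jap_pos x).le, ← mul_assoc, ← mul_pow, mul_inv_cancel₀ h0.ne', one_pow, one_mul]

theorem memHs_bessel (s : ℝ) (hs : 0 ≤ s) (g : L2) : MemHs s (bessel s hs g) := by
  rw [memHs_iff]
  exact ((Lp.memLp g).integrable_norm_pow (by norm_num)).congr
    (jap_mul_norm_fourier_bessel s hs g).symm

theorem normHs_bessel (s : ℝ) (hs : 0 ≤ s) (g : L2) :
    normHs s (bessel s hs g) = Real.sqrt (2 * Real.pi) * ‖g‖ := by
  rw [normHs_eq, integral_congr_ae (jap_mul_norm_fourier_bessel s hs g), integral_norm_sq,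
    Real.sqrt_mul (by positivity), Real.sqrt_sq (norm_nonneg _)]

theorem bessel_sub (s : ℝ) (hs : 0 ≤ s) (f g : L2) :
    bessel s hs (f - g) = bessel s hs f - bessel s hs g := by
  unfold bessel
  rw [map_sub, sub_eq_add_neg, FourierTransform.fourierInv_add, sub_eq_add_neg]
  congr 1
  rw [← neg_one_smul ℂ (mulOp _ _ g), FourierTransform.fourierInv_smul, neg_one_smul]

theorem exists_bessel_eq {s : ℝ} (hs : 0 ≤ s) {f : L2} (hf : MemHs s f) :
    ∃ g, bessel s hs g = f := by
  rw [memHs_iff] at hf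
  have hm : AEStronglyMeasurable (fun η => ((jap η ^ s : ℝ) : ℂ) * (𝓕 f : L2) η) volume :=
    (Complex.measurable_ofReal.comp (continuous_jap_rpow s).measurable).aestronglyMeasurable.mul
      (Lp.memLp _).1
  have h2 : MemLp (fun η => ((jap η ^ s : ℝ) : ℂ) * (𝓕 f : L2) η) 2 volume := by
    rw [memLp_two_iff_integrable_sq_norm hm]
    refine hf.congr (Eventually.of_forall fun η => ?_)
    simp only [norm_mul, Complex.norm_real, mul_pow, Real.norm_eq_abs, sq_abs, jap_rpow_sq]
  refine ⟨h2.toLp _, ?_⟩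
  unfold bessel
  refine Eq.trans (congrArg _ ?_) (FourierTransform.fourierInv_fourier_eq f)
  apply Lp.ext
  filter_upwards [coeFn_mulOp (isBddSymbol_jap hs) (h2.toLp _), h2.coeFn_toLp] with x h1 h3
  have h0 := Real.rpow_pos_of_pos (jap_pos x) s
  rw [h1, h3, ← mul_assoc, ← Complex.ofReal_mul, Real.rpow_neg (jap_pos x).le,
    inv_mul_cancel₀ h0.ne', Complex.ofReal_one, one_mul]

end Sobolev

open scoped Convolution

/-! ### The isomorphism between g and u, and the symbols of the equation -/

section Physical

variable {α σ : ℝ}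

theorem isBddSymbol_weight_inv (hα : 0 ≤ α) (σ : ℝ) :
    IsBddSymbol fun η => (((weight α σ η)⁻¹ : ℝ) : ℂ) :=
  isBddSymbol_ofReal (continuous_weight α σ).measurable.inv 1 zero_le_one fun x => by
    rw [abs_of_pos (inv_pos.2 (weight_pos _ _ _))]
    exact inv_le_one_of_one_le₀ (one_le_weight hα σ x)

/-- The function of the space variable with `F f = g / weight`. -/
noncomputable def physical (hα : 0 ≤ α) (σ : ℝ) : L2 →L[ℂ] L2 :=
  (fourierInvCLM ℂ L2).comp (mulOp _ (isBddSymbol_weight_inv hα σ))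

theorem physical_apply (hα : 0 ≤ α) (σ : ℝ) (g : L2) :
    physical hα σ g = 𝓕⁻ (mulOp _ (isBddSymbol_weight_inv hα σ) g) := rfl

theorem fourierInv_injective : Function.Injective (fun f : L2 => (𝓕⁻ f : L2)) :=
  (Lp.fourierTransformₗᵢ ℝ ℂ).symm.injective

theorem physical_injective (hα : 0 ≤ α) (σ : ℝ) : Function.Injective (physical hα σ) :=
  fourierInv_injective.comp (mulOp_injective _ fun _ =>
    Complex.ofReal_ne_zero.2 (inv_pos.2 (weight_pos _ _ _)).ne')

theorem mSymbol_eq (σ η : ℝ) : mSymbol σ (2 * Real.pi * η) = (coshSymbol σ η : ℂ) := by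
  unfold mSymbol coshSymbol
  rw [Real.cosh_eq]

theorem mSymbol_mul_weight_inv (α σ η : ℝ) :
    mSymbol σ (2 * Real.pi * η) * (((weight α σ η)⁻¹ : ℝ) : ℂ) =
      ((jap η ^ (-(α / 2)) : ℝ) : ℂ) := by
  rw [mSymbol_eq, ← Complex.ofReal_mul, weight, Real.rpow_neg (jap_pos η).le, mul_inv,
    mul_left_comm, mul_inv_cancel₀ (coshSymbol_pos σ η).ne', mul_one]

theorem inDomain_mSymbol_physical (hα : 0 ≤ α) (σ : ℝ) (g : L2) :
    InDomain (mSymbol σ) (physical hα σ g) :=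
  inDomain_fourierInv_mulOp _ (isBddSymbol_jap (div_nonneg hα zero_le_two))
    (mSymbol_mul_weight_inv α σ) g

theorem opI_physical (hα : 0 ≤ α) (σ : ℝ) (g : L2) :
    opI σ (physical hα σ g) = bessel (α / 2) (div_nonneg hα zero_le_two) g :=
  multiplier_fourierInv_mulOp _ _ (mSymbol_mul_weight_inv α σ) g

theorem opIMemHs_physical (hα : 0 ≤ α) (σ : ℝ) (g : L2) :
    OpIMemHs σ (α / 2) (physical hα σ g) :=
  ⟨inDomain_mSymbol_physical hα σ g, by
    rw [opI_physical]; exact memHs_bessel _ (div_nonneg hα zero_le_two) g⟩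

theorem normHs_opI_physical (hα : 0 ≤ α) (σ : ℝ) (g : L2) :
    normHs (α / 2) (opI σ (physical hα σ g)) = Real.sqrt (2 * Real.pi) * ‖g‖ := by
  rw [opI_physical, normHs_bessel]

theorem normHs_opI_physical_sub (hα : 0 ≤ α) (σ : ℝ) (f g : L2) :
    normHs (α / 2) (opI σ (physical hα σ f) - opI σ (physical hα σ g)) =
      Real.sqrt (2 * Real.pi) * ‖f - g‖ := by
  rw [opI_physical, opI_physical, ← bessel_sub, normHs_bessel]

/-- Surjectivity. Together with `physical_injective` and `normHs_opI_physical` it identifies the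
solution space with L², isometrically up to √(2π). -/
theorem exists_physical_eq (hα : 0 ≤ α) {u : L2} (hu : OpIMemHs σ (α / 2) u) :
    ∃ g, physical hα σ g = u := by
  obtain ⟨g, hg⟩ := exists_bessel_eq (div_nonneg hα zero_le_two) hu.2
  refine ⟨g, ?_⟩
  have h1 := coeFn_fourier_multiplier hu.1
  change (𝓕 (opI σ u) : L2) =ᵐ[volume] _ at h1
  rw [← hg, bessel, FourierTransform.fourier_fourierInv_eq] at h1
  rw [physical_apply]
  refine Eq.trans (congrArg _ ?_) (FourierTransform.fourierInv_fourier_eq u)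
  apply Lp.ext
  filter_upwards [h1, coeFn_mulOp (isBddSymbol_weight_inv hα σ) g,
    coeFn_mulOp (isBddSymbol_jap (div_nonneg hα zero_le_two)) g] with x h1 h2 h3
  have hc : (coshSymbol σ x : ℂ) ≠ 0 := Complex.ofReal_ne_zero.2 (coshSymbol_pos σ x).ne'
  rw [h3, ← mSymbol_mul_weight_inv α σ, mul_assoc, mSymbol_eq] at h1
  rw [h2]
  exact mul_left_cancel₀ hc h1

/-- The symbol `ξ / (1 + |ξ|^α)` in the variable `η = ξ / 2π`. -/
noncomputable def evReal (α η : ℝ) : ℝ := 2 * Real.pi * η / (1 + |2 * Real.pi * η| ^ α)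

/-- The symbol `-iξ / (1 + |ξ|^α)` in the variable `η = ξ / 2π`. -/
noncomputable def evSymbol (α η : ℝ) : ℂ := -Complex.I * (evReal α η : ℂ)

theorem one_add_abs_rpow_pos (α ξ : ℝ) : 0 < 1 + |ξ| ^ α := by
  have := Real.rpow_nonneg (abs_nonneg ξ) α
  linarith

theorem abs_evReal_le (hα : 1 ≤ α) (η : ℝ) : |evReal α η| ≤ 1 := by
  unfold evReal
  set ξ := 2 * Real.pi * η
  rw [abs_div, abs_of_pos (one_add_abs_rpow_pos α ξ), div_le_one (one_add_abs_rpow_pos α ξ)]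
  rcases le_total |ξ| 1 with h | h
  · have := Real.rpow_nonneg (abs_nonneg ξ) α
    linarith
  · have := Real.self_le_rpow_of_one_le h hα
    linarith

theorem measurable_evReal (α : ℝ) : Measurable (evReal α) := by
  unfold evReal; fun_prop

theorem norm_evSymbol_le (hα : 1 ≤ α) (η : ℝ) : ‖evSymbol α η‖ ≤ 1 := by
  unfold evSymbol
  rw [norm_mul, norm_neg, Complex.norm_I, one_mul, Complex.norm_real]
  exact abs_evReal_le hα η

theorem isBddSymbol_evSymbol (hα : 1 ≤ α) : IsBddSymbol (evSymbol α) where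
  meas := (Complex.measurable_ofReal.comp (measurable_evReal α)).const_mul _
  bdd := ⟨1, zero_le_one, norm_evSymbol_le hα⟩

theorem conj_evSymbol (α η : ℝ) : (starRingEnd ℂ) (evSymbol α η) = -evSymbol α η := by
  simp [evSymbol]

theorem conj_evSymbol_neg (α η : ℝ) : (starRingEnd ℂ) (evSymbol α (-η)) = evSymbol α η := by
  have : evReal α (-η) = -evReal α η := by simp [evReal, neg_div]
  rw [evSymbol, evSymbol, this, map_mul, Complex.conj_ofReal]
  simp

theorem abs_le_cosh (x : ℝ) : |x| ≤ Real.cosh x := by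
  rw [← Real.cosh_abs]
  exact (Real.self_le_sinh_iff.2 (abs_nonneg x)).trans (Real.sinh_lt_cosh _).le

/-- Since σ|ξ| ≤ cosh(σξ), the hyperbolic weight absorbs a derivative. The loss σ⁻¹ is harmless: the
bound serves only to place functions in L¹ or L² and enters no final constant. -/
theorem abs_mul_weight_inv_le (hσ : 0 < σ) (α η : ℝ) :
    |2 * Real.pi * η * (weight α σ η)⁻¹| ≤ σ⁻¹ * jap η ^ (-(α / 2)) := by
  have hc := coshSymbol_pos σ η
  have hj := Real.rpow_pos_of_pos (jap_pos η) (α / 2)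
  have h : |2 * Real.pi * η| ≤ σ⁻¹ * coshSymbol σ η := by
    have := abs_le_cosh (σ * (2 * Real.pi * η))
    rw [abs_mul, abs_of_pos hσ] at this
    rw [inv_mul_eq_div, le_div_iff₀ hσ, mul_comm]
    exact this
  rw [abs_mul, abs_of_pos (inv_pos.2 (weight_pos _ _ _)), weight, mul_inv,
    Real.rpow_neg (jap_pos η).le]
  calc _ ≤ σ⁻¹ * coshSymbol σ η * ((jap η ^ (α / 2))⁻¹ * (coshSymbol σ η)⁻¹) := by gcongr
    _ = _ := by field_simp

/-- The symbol of `∂ₓ` divided by the weight. -/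
noncomputable def dxWeight (α σ η : ℝ) : ℂ :=
  Complex.I * ((2 * Real.pi * η * (weight α σ η)⁻¹ : ℝ) : ℂ)

theorem norm_dxWeight_le (hσ : 0 < σ) (α η : ℝ) :
    ‖dxWeight α σ η‖ ≤ σ⁻¹ * jap η ^ (-(α / 2)) := by
  unfold dxWeight
  rw [norm_mul, Complex.norm_I, one_mul, Complex.norm_real]
  exact abs_mul_weight_inv_le hσ α η

theorem isBddSymbol_dxWeight (hα : 0 ≤ α) (hσ : 0 < σ) : IsBddSymbol (dxWeight α σ) where
  meas := (Complex.measurable_ofReal.comp ((measurable_id.const_mul _).mul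
    (continuous_weight α σ).measurable.inv)).const_mul _
  bdd := ⟨σ⁻¹, (inv_pos.2 hσ).le, fun η => (norm_dxWeight_le hσ α η).trans
    (mul_le_of_le_one_right (inv_pos.2 hσ).le
      (Real.rpow_le_one_of_one_le_of_nonpos (one_le_jap η) (by linarith)))⟩

theorem dxSymbol_mul_weight_inv (α σ η : ℝ) :
    dxSymbol (2 * Real.pi * η) * (((weight α σ η)⁻¹ : ℝ) : ℂ) = dxWeight α σ η := by
  unfold dxSymbol dxWeight
  push_cast
  ring

theorem inDomain_dxSymbol_physical (hα : 0 ≤ α) (hσ : 0 < σ) (g : L2) :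
    InDomain dxSymbol (physical hα σ g) :=
  inDomain_fourierInv_mulOp _ (isBddSymbol_dxWeight hα hσ) (dxSymbol_mul_weight_inv α σ) g

theorem opDx_physical (hα : 0 ≤ α) (hσ : 0 < σ) (g : L2) :
    opDx (physical hα σ g) = 𝓕⁻ (mulOp _ (isBddSymbol_dxWeight hα hσ) g) :=
  multiplier_fourierInv_mulOp _ _ (dxSymbol_mul_weight_inv α σ) g

theorem memLp_jap_rpow (hα : 1 < α) : MemLp (fun η => jap η ^ (-(α / 2))) 2 volume := by
  rw [memLp_two_iff_integrable_sq (continuous_jap_rpow _).aestronglyMeasurable]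
  refine (integrable_jap_rpow hα).congr (Eventually.of_forall fun η => ?_)
  dsimp only
  rw [← jap_rpow_sq]
  congr 1; ring

/-- Cauchy–Schwarz, with (1+|ξ|)^{-α/2} in L². Integrability on the Fourier side gives access to the
pointwise inversion integral. -/
theorem integrable_mulOp {a : ℝ → ℂ} (ha : IsBddSymbol a) (hα : 1 < α) {C : ℝ}
    (h : ∀ η, ‖a η‖ ≤ C * jap η ^ (-(α / 2))) (g : L2) : Integrable (mulOp a ha g) := by
  have h2 : MemLp a 2 volume := (memLp_jap_rpow hα).of_le_mul (c := C)
    ha.meas.aestronglyMeasurable (Eventually.of_forall fun η => by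
      rw [Real.norm_of_nonneg (Real.rpow_pos_of_pos (jap_pos η) _).le]; exact h η)
  exact (h2.integrable_mul (Lp.memLp g)).congr (coeFn_mulOp ha g).symm

theorem norm_weight_inv_le (α σ η : ℝ) :
    ‖(((weight α σ η)⁻¹ : ℝ) : ℂ)‖ ≤ 1 * jap η ^ (-(α / 2)) := by
  rw [Complex.norm_real, Real.norm_of_nonneg (inv_pos.2 (weight_pos _ _ _)).le, weight, mul_inv,
    Real.rpow_neg (jap_pos η).le, one_mul]
  exact mul_le_of_le_one_right (inv_pos.2 (Real.rpow_pos_of_pos (jap_pos η) _)).le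
    (inv_le_one_of_one_le₀ (one_le_coshSymbol σ η))

theorem coeFn_fourierInv_of_integrable (f : L2) (hf : Integrable f) :
    ((𝓕⁻ f : L2) : ℝ → ℂ) =ᵐ[volume] (𝓕⁻ (f : ℝ → ℂ) : ℝ → ℂ) := by
  have := coeFn_fourierInv_toLp hf (Lp.memLp f)
  rwa [Lp.toLp_coeFn] at this

theorem fourierInv_fun_congr_ae {f g : ℝ → ℂ} (h : f =ᵐ[volume] g) :
    (𝓕⁻ f : ℝ → ℂ) = 𝓕⁻ g := by
  ext x
  rw [Real.fourierInv_eq_fourier_neg, Real.fourierInv_eq_fourier_neg, Real.fourier_congr_ae h]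

/-- Complex conjugation on the Fourier side. -/
theorem coeFn_physical_conjNeg (hα : 1 < α) (σ : ℝ) (g : L2) :
    physical (zero_lt_one.trans hα).le σ (conjNeg g) =ᵐ[volume]
      fun x => (starRingEnd ℂ) (physical (zero_lt_one.trans hα).le σ g x) := by
  have hb := isBddSymbol_weight_inv (zero_lt_one.trans hα).le σ
  have h1 := coeFn_fourierInv_of_integrable _
    (integrable_mulOp hb hα (norm_weight_inv_le α σ) g)
  have h2 := coeFn_fourierInv_of_integrable _
    (integrable_mulOp hb hα (norm_weight_inv_le α σ) (conjNeg g))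
  have h3 : mulOp _ hb (conjNeg g) = conjNeg (mulOp _ hb g) :=
    (conjNeg_mulOp hb (fun x => by rw [weight_neg, Complex.conj_ofReal]) g).symm
  have h4 := fourierInv_fun_congr_ae (coeFn_conjNeg (mulOp _ hb g))
  rw [physical_apply, physical_apply]
  filter_upwards [h1, h2] with x e1 e2
  rw [e1, e2, h3, h4, conj_fourierInv]

/-- The weight is real and even, so the Hermitian symmetry of û is that of g. -/
theorem isRealValued_physical_iff (hα : 1 < α) (σ : ℝ) (g : L2) :
    IsRealValued (physical (zero_lt_one.trans hα).le σ g) ↔ conjNeg g = g := by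
  have h := coeFn_physical_conjNeg hα σ g
  constructor
  · intro hr
    apply physical_injective (zero_lt_one.trans hα).le σ
    apply Lp.ext
    filter_upwards [h, hr] with x h1 h2
    rw [h1, Complex.conj_eq_iff_im.2 h2]
  · intro hg
    rw [hg] at h
    filter_upwards [h] with x hx
    exact Complex.conj_eq_iff_im.1 hx.symm

end Physical

/-! ### The equation in the Fourier variables -/

section Equation

variable {α σ C : ℝ}

theorem fourierInv_add_L2 (f g : L2) : (𝓕⁻ (f + g) : L2) = 𝓕⁻ f + 𝓕⁻ g :=
  (fourierInvCLM ℂ L2).map_add f g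

/-- The identity u uₓ = ½(u²)ₓ. The substitution y ↦ x - y moves the frequency factor to the other
copy of φ, and the two factors add up to x. -/
theorem convolution_mul_dx {φ : ℝ → ℂ} (h₁ : MemLp φ 2 volume)
    (h₂ : MemLp (fun η => Complex.I * ((2 * Real.pi * η : ℝ) : ℂ) * φ η) 2 volume) (x : ℝ) :
    (φ ⋆[ContinuousLinearMap.mul ℂ ℂ, volume]
      fun η => Complex.I * ((2 * Real.pi * η : ℝ) : ℂ) * φ η) x =
      Complex.I * ((2 * Real.pi * x : ℝ) : ℂ) * (1 / 2) * ∫ y, φ y * φ (x - y) := by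
  rw [convolution_mul]
  set ψ : ℝ → ℂ := fun η => Complex.I * ((2 * Real.pi * η : ℝ) : ℂ) * φ η with hψ
  have i1 : Integrable fun y => φ y * ψ (x - y) := h₁.integrable_mul (memLp_comp_sub_left h₂ x)
  have i2 : Integrable fun y => φ (x - y) * ψ y := (memLp_comp_sub_left h₁ x).integrable_mul h₂
  have e : ∫ y, φ y * ψ (x - y) = ∫ y, φ (x - y) * ψ y := by
    rw [← integral_sub_left_eq_self _ volume x]
    simp
  have e2 : (∫ y, φ y * ψ (x - y)) + (∫ y, φ (x - y) * ψ y) =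
      Complex.I * ((2 * Real.pi * x : ℝ) : ℂ) * ∫ y, φ y * φ (x - y) := by
    rw [← integral_add i1 i2, ← integral_const_mul]
    congr 1
    ext y
    simp only [hψ]
    push_cast
    ring
  rw [← e] at e2
  linear_combination (1 / 2) * e2

/-- The nonlinearity `u uₓ` on the Fourier side. -/
theorem coeFn_mul_opDx_physical (hα : 1 < α) (hσ : 0 < σ) (hW : IsConvWeight (weight α σ) C)
    (g : L2) :
    (fun x => physical (zero_lt_one.trans hα).le σ g x *
      opDx (physical (zero_lt_one.trans hα).le σ g) x) =ᵐ[volume]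
    (𝓕⁻ (mulOp _ (isBddSymbol_dxWeight (zero_lt_one.trans hα).le hσ)
      ((1 / 2 : ℂ) • convOp _ hW g g)) : L2) := by
  have hα0 := (zero_lt_one.trans hα).le
  set φ : ℝ → ℂ := fun η => (((weight α σ η)⁻¹ : ℝ) : ℂ) * g η with hφ
  set ψ : ℝ → ℂ := fun η => Complex.I * ((2 * Real.pi * η : ℝ) : ℂ) * φ η with hψ
  have hb := isBddSymbol_weight_inv hα0 σ
  have hd := isBddSymbol_dxWeight hα0 hσ
  have hψ' : ∀ η, ψ η = dxWeight α σ η * g η := fun η => by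
    simp only [hψ, hφ, dxWeight]; push_cast; ring
  have m1 : MemLp φ 2 volume := hb.memLp (Lp.memLp g)
  have m2 : MemLp ψ 2 volume := by
    simpa only [← hψ'] using hd.memLp (Lp.memLp g)
  have eφ : mulOp _ hb g =ᵐ[volume] φ := coeFn_mulOp hb g
  have eψ : mulOp _ hd g =ᵐ[volume] ψ := by
    filter_upwards [coeFn_mulOp hd g] with x hx
    rw [hx, hψ']
  have i1' := integrable_mulOp hb hα (norm_weight_inv_le α σ) g
  have i2' := integrable_mulOp hd hα (norm_dxWeight_le hσ α) g
  have i1 : Integrable φ := i1'.congr eφ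
  have i2 : Integrable ψ := i2'.congr eψ
  have h1 := coeFn_fourierInv_of_integrable _ i1'
  have h2 := coeFn_fourierInv_of_integrable _ i2'
  rw [fourierInv_fun_congr_ae eφ] at h1
  rw [fourierInv_fun_congr_ae eψ] at h2
  set k : L2 := mulOp _ hd ((1 / 2 : ℂ) • convOp _ hW g g) with hk
  have ek : k =ᵐ[volume] (φ ⋆[ContinuousLinearMap.mul ℂ ℂ, volume] ψ) := by
    filter_upwards [coeFn_mulOp hd ((1 / 2 : ℂ) • convOp _ hW g g),
      Lp.coeFn_smul (1 / 2 : ℂ) (convOp _ hW g g), coeFn_convOp hW g g] with x e1 e2 e3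
    rw [hk, e1, e2, Pi.smul_apply, e3, convolution_mul_dx m1 m2, weightedConv, dxWeight]
    have hw : ((weight α σ x : ℝ) : ℂ) ≠ 0 := Complex.ofReal_ne_zero.2 (weight_pos _ _ _).ne'
    simp only [smul_eq_mul, hφ]
    push_cast
    field_simp
  have ik : Integrable (φ ⋆[ContinuousLinearMap.mul ℂ ℂ, volume] ψ) :=
    i1.integrable_convolution _ i2
  have h3 := coeFn_fourierInv_of_integrable k (ik.congr ek.symm)
  rw [fourierInv_fun_congr_ae ek] at h3
  rw [opDx_physical hα0 hσ, physical_apply]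
  filter_upwards [h1, h2, h3] with x e1 e2 e3
  rw [e1, e2, e3, fourierInv_convolution i1 i2]

/-- The quadratic part of the equation in the Fourier variables. -/
noncomputable def quadOp (hα : 1 ≤ α) (hW : IsConvWeight (weight α σ) C) :
    L2 →L[ℂ] L2 →L[ℂ] L2 :=
  (ContinuousLinearMap.compL ℂ L2 L2 L2
    ((1 / 2 : ℂ) • mulOp _ (isBddSymbol_evSymbol hα))).comp (convOp _ hW)

theorem quadOp_apply (hα : 1 ≤ α) (hW : IsConvWeight (weight α σ) C) (g h : L2) :
    quadOp hα hW g h = mulOp _ (isBddSymbol_evSymbol hα) ((1 / 2 : ℂ) • convOp _ hW g h) := by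
  simp [quadOp]

theorem norm_quadOp_le (hα : 1 ≤ α) (hW : IsConvWeight (weight α σ) C) (g h : L2) :
    ‖quadOp hα hW g h‖ ≤ C * ‖g‖ * ‖h‖ := by
  rw [quadOp_apply]
  refine (norm_mulOp_le _ (norm_evSymbol_le hα) _).trans ?_
  rw [one_mul, norm_smul]
  have h1 := norm_convOp_le hW g h
  have h2 := norm_nonneg (convOp _ hW g h)
  norm_num
  linarith

/-- The right-hand side of the equation in the Fourier variables. -/
noncomputable def vectorField (hα : 1 ≤ α) (hW : IsConvWeight (weight α σ) C) (g : L2) : L2 :=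
  mulOp _ (isBddSymbol_evSymbol hα) g + quadOp hα hW g g

theorem vectorField_eq (hα : 1 ≤ α) (hW : IsConvWeight (weight α σ) C) (g : L2) :
    vectorField hα hW g =
      mulOp _ (isBddSymbol_evSymbol hα) (g + (1 / 2 : ℂ) • convOp _ hW g g) := by
  rw [vectorField, quadOp_apply, map_add]

theorem continuous_vectorField (hα : 1 ≤ α) (hW : IsConvWeight (weight α σ) C) :
    Continuous (vectorField hα hW) := by
  unfold vectorField; fun_prop

theorem half_smul_eq (f : L2) : (1 / 2 : ℂ) • f = (1 / 2 : ℝ) • f := by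
  apply Lp.ext
  filter_upwards [Lp.coeFn_smul (1 / 2 : ℂ) f, Lp.coeFn_smul (1 / 2 : ℝ) f] with x h1 h2
  rw [h1, h2]
  simp

theorem conjNeg_vectorField (hα : 1 ≤ α) (hW : IsConvWeight (weight α σ) C) (g : L2) :
    conjNeg (vectorField hα hW g) = vectorField hα hW (conjNeg g) := by
  rw [vectorField_eq, vectorField_eq, conjNeg_mulOp _ (conj_evSymbol_neg α), map_add,
    half_smul_eq, half_smul_eq, map_smul, conjNeg_convOp hW (weight_neg α σ)]

theorem dSymbol_eq (α η : ℝ) : dSymbol α (2 * Real.pi * η) = ((|2 * Real.pi * η| ^ α : ℝ) : ℂ) :=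
  rfl

theorem evSymbol_mul (α η : ℝ) :
    (1 + dSymbol α (2 * Real.pi * η)) * evSymbol α η = -(Complex.I * (2 * Real.pi * η : ℝ)) := by
  have h : (1 + ((|2 * Real.pi * η| ^ α : ℝ) : ℂ)) ≠ 0 := by
    exact_mod_cast (one_add_abs_rpow_pos α (2 * Real.pi * η)).ne'
  rw [dSymbol_eq, evSymbol, evReal, Complex.ofReal_div, Complex.ofReal_add, Complex.ofReal_one]
  field_simp

theorem isBddSymbol_evSymbol_weight (hα : 1 ≤ α) (σ : ℝ) :
    IsBddSymbol fun η => (((weight α σ η)⁻¹ : ℝ) : ℂ) * evSymbol α η :=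
  (isBddSymbol_weight_inv (zero_le_one.trans hα) σ).mul (isBddSymbol_evSymbol hα)

theorem physical_mulOp_evSymbol (hα : 1 ≤ α) (σ : ℝ) (k : L2) :
    physical (zero_le_one.trans hα) σ (mulOp _ (isBddSymbol_evSymbol hα) k) =
      𝓕⁻ (mulOp _ (isBddSymbol_evSymbol_weight hα σ) k) := by
  rw [physical_apply, mulOp_mulOp _ _ (isBddSymbol_evSymbol_weight hα σ) fun _ => rfl]

/-- Because (1+|ξ|^α) times the evolution symbol is -iξ, the symbol here equals minus the sum of two
bounded ones. This is what makes D^α uₜ square integrable. -/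
theorem isBddSymbol_dSymbol_evSymbol (hα : 1 ≤ α) (hσ : 0 < σ) : IsBddSymbol fun η =>
    dSymbol α (2 * Real.pi * η) * ((((weight α σ η)⁻¹ : ℝ) : ℂ) * evSymbol α η) := by
  have h1 := (isBddSymbol_const (-1)).mul ((isBddSymbol_dxWeight (zero_le_one.trans hα) hσ).add
    (isBddSymbol_evSymbol_weight hα σ))
  convert h1 using 2 with η
  have := evSymbol_mul α η
  rw [dxWeight]
  push_cast at this ⊢
  linear_combination ((weight α σ η : ℂ))⁻¹ * this

/-- The equation in the Fourier variables. -/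
theorem solvesAt_iff (hα : 1 < α) (hσ : 0 < σ) (hW : IsConvWeight (weight α σ) C) {J : Set ℝ}
    {w : ℝ → L2} {t : ℝ} {g : L2} (hw : w t = physical (zero_lt_one.trans hα).le σ g) :
    SolvesAt α J w t ↔ HasDerivWithinAt w
      (physical (zero_lt_one.trans hα).le σ (vectorField hα.le hW g)) J t := by
  have hα0 := (zero_lt_one.trans hα).le
  have hd := isBddSymbol_dxWeight hα0 hσ
  set N : L2 := (1 / 2 : ℂ) • convOp _ hW g g with hN
  have hmul := coeFn_mul_opDx_physical hα hσ hW g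
  have hP := physical_mulOp_evSymbol hα.le σ (g + N)
  have hsum : (𝓕⁻ (mulOp _ hd (g + N)) : L2) = 𝓕⁻ (mulOp _ hd g) + 𝓕⁻ (mulOp _ hd N) := by
    rw [map_add, fourierInv_add_L2]
  rw [vectorField_eq]
  constructor
  · rintro ⟨wt, hder, hdom, -, heq⟩
    convert hder
    rw [hP]
    refine Eq.trans (congrArg _ ?_) (FourierTransform.fourierInv_fourier_eq wt)
    have e1 : wt + opD α wt + 𝓕⁻ (mulOp _ hd (g + N)) = 0 := by
      rw [hsum]
      apply Lp.ext
      rw [hw, opDx_physical hα0 hσ] at heq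
      rw [opDx_physical hα0 hσ] at hmul
      filter_upwards [heq, hmul, Lp.coeFn_add (wt + opD α wt)
          ((𝓕⁻ (mulOp _ hd g) : L2) + 𝓕⁻ (mulOp _ hd N)), Lp.coeFn_add wt (opD α wt),
          Lp.coeFn_add (𝓕⁻ (mulOp _ hd g) : L2) (𝓕⁻ (mulOp _ hd N)), Lp.coeFn_zero ℂ 2 volume]
        with x h1 h2 h3 h4 h5 h6
      rw [h3, Pi.add_apply, h4, h5, Pi.add_apply, Pi.add_apply, h6, Pi.zero_apply, ← h2, ← h1]
      ring
    have e2 := congrArg (fun f : L2 => (𝓕 f : L2)) e1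
    simp only [FourierTransform.fourier_add, FourierTransform.fourier_fourierInv_eq] at e2
    have e3 : (𝓕 (0 : L2) : L2) = 0 := (Lp.fourierTransformₗᵢ ℝ ℂ).map_zero
    rw [e3] at e2
    apply Lp.ext
    have hz := Lp.coeFn_add (𝓕 wt + 𝓕 (opD α wt) : L2) (mulOp _ hd (g + N))
    rw [e2] at hz
    filter_upwards [coeFn_mulOp (isBddSymbol_evSymbol_weight hα.le σ) (g + N), hz,
      Lp.coeFn_add (𝓕 wt : L2) (𝓕 (opD α wt)), coeFn_fourier_multiplier hdom,
      coeFn_mulOp hd (g + N), Lp.coeFn_zero ℂ 2 volume] with x h1 h2 h3 h4 h5 h6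
    change (𝓕 (opD α wt) : L2) x = _ at h4
    rw [h6, Pi.zero_apply, Pi.add_apply, h3, Pi.add_apply, h4, h5] at h2
    rw [h1]
    -- The equation determines uₜ because 1 + D^α can be inverted frequency by frequency.
    have h7 : (1 + dSymbol α (2 * Real.pi * x)) ≠ 0 := by
      rw [dSymbol_eq]
      exact_mod_cast (one_add_abs_rpow_pos α (2 * Real.pi * x)).ne'
    apply mul_left_cancel₀ h7
    have h8 := evSymbol_mul α x
    rw [dxWeight] at h2
    push_cast at h2 h8 ⊢
    linear_combination ((weight α σ x : ℂ))⁻¹ * (g + N : L2) x * h8 + h2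
  · intro hder
    refine ⟨_, hder, ?_, ?_, ?_⟩
    · rw [hP]
      exact inDomain_fourierInv_mulOp _ (isBddSymbol_dSymbol_evSymbol hα.le hσ) (fun _ => rfl) _
    · rw [hw]
      exact inDomain_dxSymbol_physical hα0 hσ g
    · rw [hP, hw]
      have h1 : opD α (𝓕⁻ (mulOp _ (isBddSymbol_evSymbol_weight hα.le σ) (g + N)) : L2) =
          𝓕⁻ (mulOp _ (isBddSymbol_dSymbol_evSymbol hα.le hσ) (g + N)) :=
        multiplier_fourierInv_mulOp _ _ (fun _ => rfl) _
      rw [h1]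
      have e1 : (𝓕⁻ (mulOp _ (isBddSymbol_evSymbol_weight hα.le σ) (g + N)) : L2) +
          𝓕⁻ (mulOp _ (isBddSymbol_dSymbol_evSymbol hα.le hσ) (g + N)) +
          (𝓕⁻ (mulOp _ hd g) + 𝓕⁻ (mulOp _ hd N)) = 0 := by
        rw [← hsum, ← fourierInv_add_L2, ← fourierInv_add_L2]
        have e3 : (𝓕⁻ (0 : L2) : L2) = 0 := (Lp.fourierTransformₗᵢ ℝ ℂ).symm.map_zero
        rw [← e3]
        congr 1
        apply Lp.ext
        filter_upwards [coeFn_mulOp (isBddSymbol_evSymbol_weight hα.le σ) (g + N),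
          coeFn_mulOp (isBddSymbol_dSymbol_evSymbol hα.le hσ) (g + N), coeFn_mulOp hd (g + N),
          Lp.coeFn_zero ℂ 2 volume,
          Lp.coeFn_add (mulOp _ (isBddSymbol_evSymbol_weight hα.le σ) (g + N) +
            mulOp _ (isBddSymbol_dSymbol_evSymbol hα.le hσ) (g + N)) (mulOp _ hd (g + N)),
          Lp.coeFn_add (mulOp _ (isBddSymbol_evSymbol_weight hα.le σ) (g + N))
            (mulOp _ (isBddSymbol_dSymbol_evSymbol hα.le hσ) (g + N))]
          with x h1 h2 h3 h4 h5 h6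
        rw [h5, Pi.add_apply, h6, Pi.add_apply, h1, h2, h3, h4, Pi.zero_apply, dxWeight]
        have h8 := evSymbol_mul α x
        push_cast at h8 ⊢
        linear_combination ((weight α σ x : ℂ))⁻¹ * (g + N : L2) x * h8
      have h0 := Lp.coeFn_zero ℂ 2 (volume : Measure ℝ)
      rw [← e1] at h0
      rw [opDx_physical hα0 hσ] at hmul ⊢
      filter_upwards [h0, hmul,
        Lp.coeFn_add ((𝓕⁻ (mulOp _ (isBddSymbol_evSymbol_weight hα.le σ) (g + N)) : L2) +
          𝓕⁻ (mulOp _ (isBddSymbol_dSymbol_evSymbol hα.le hσ) (g + N)))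
          ((𝓕⁻ (mulOp _ hd g) : L2) + 𝓕⁻ (mulOp _ hd N)),
        Lp.coeFn_add (𝓕⁻ (mulOp _ (isBddSymbol_evSymbol_weight hα.le σ) (g + N)) : L2)
          (𝓕⁻ (mulOp _ (isBddSymbol_dSymbol_evSymbol hα.le hσ) (g + N))),
        Lp.coeFn_add (𝓕⁻ (mulOp _ hd g) : L2) (𝓕⁻ (mulOp _ hd N))] with x h2 h3 h4 h5 h6
      rw [h4, Pi.add_apply, h5, h6, Pi.add_apply, Pi.add_apply, ← h3, Pi.zero_apply] at h2
      rw [← h2]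
      ring

end Equation

/-! ### Local well-posedness -/

section WellPosed

variable {α σ C δ : ℝ}

theorem hasDerivWithinAt_physical (hα : 0 ≤ α) (σ : ℝ) {g : ℝ → L2} {k : L2} {J : Set ℝ} {t : ℝ}
    (h : HasDerivWithinAt g k J t) :
    HasDerivWithinAt (fun s => physical hα σ (g s)) (physical hα σ k) J t :=
  ((physical hα σ).restrictScalars ℝ).hasFDerivAt.comp_hasDerivWithinAt t h

/-- A solution is, in the Fourier variables, an integral curve of the vector field. -/
theorem IsSolution.exists_curve (hα : 1 < α) (hσ : 0 < σ) (hW : IsConvWeight (weight α σ) C)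
    {u₀ : L2} {u : ℝ → L2} (hu : IsSolution α σ δ u₀ u) :
    ∃ g : ℝ → L2, (∀ t ∈ Icc 0 δ, physical (zero_lt_one.trans hα).le σ (g t) = u t) ∧
      (∀ t ∈ Icc 0 δ, conjNeg (g t) = g t) ∧
      ∀ t ∈ Icc 0 δ, HasDerivWithinAt g (vectorField hα.le hW (g t)) (Icc 0 δ) t := by
  have hα0 := (zero_lt_one.trans hα).le
  have hex : ∀ t, ∃ g : L2, t ∈ Icc 0 δ → physical hα0 σ g = u t := fun t => by
    by_cases ht : t ∈ Icc 0 δ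
    · obtain ⟨g, hg⟩ := exists_physical_eq hα0 (hu.mem t ht)
      exact ⟨g, fun _ => hg⟩
    · exact ⟨0, fun h => absurd h ht⟩
  choose g hg using hex
  have hcont : ContinuousOn g (Icc 0 δ) := fun t ht => by
    have h1 := hu.cont t ht
    have h2 : (fun s => normHs (α / 2) (opI σ (u s) - opI σ (u t))) =ᶠ[𝓝[Icc 0 δ] t]
        fun s => Real.sqrt (2 * Real.pi) * ‖g s - g t‖ := by
      filter_upwards [self_mem_nhdsWithin] with s hs
      rw [← hg s hs, ← hg t ht, normHs_opI_physical_sub hα0]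
    have h3 := (h1.congr' h2).const_mul (Real.sqrt (2 * Real.pi))⁻¹
    have h4 : Real.sqrt (2 * Real.pi) ≠ 0 := (Real.sqrt_pos.2 (by positivity)).ne'
    simp only [inv_mul_cancel_left₀ h4, mul_zero] at h3
    exact tendsto_iff_norm_sub_tendsto_zero.2 h3
  refine ⟨g, hg, fun t ht => ?_, ?_⟩
  · have := hu.real_valued t ht
    rw [← hg t ht] at this
    exact (isRealValued_physical_iff hα σ (g t)).1 this
  -- The solution is differentiable only in the weaker L² topology of u. Continuity of g and of the
  -- field along it upgrade this to differentiability of g itself.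
  · refine hasDerivWithinAt_of_injective (physical hα0 σ) (physical_injective hα0 σ) hcont
      ((continuous_vectorField hα.le hW).comp_continuousOn hcont) fun t ht => ?_
    have h1 := (solvesAt_iff hα hσ hW (hg t ht).symm).1 (hu.equation t ht)
    exact h1.congr (fun s hs => hg s hs) (hg t ht)

theorem eqOn_of_vectorField (hα : 1 ≤ α) (hW : IsConvWeight (weight α σ) C) {g h : ℝ → L2}
    (hg : ∀ t ∈ Icc 0 δ, HasDerivWithinAt g (vectorField hα hW (g t)) (Icc 0 δ) t)
    (hh : ∀ t ∈ Icc 0 δ, HasDerivWithinAt h (vectorField hα hW (h t)) (Icc 0 δ) t)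
    (h0 : g 0 = h 0) : EqOn g h (Icc 0 δ) :=
  eqOn_of_hasDerivWithinAt_quadratic _ hW.nonneg (norm_quadOp_le hα hW) hg hh h0

/-- An integral curve of the vector field with real initial value gives a solution. -/
theorem isSolution_physical (hα : 1 < α) (hσ : 0 < σ) (hW : IsConvWeight (weight α σ) C)
    {g : ℝ → L2} (h0 : conjNeg (g 0) = g 0)
    (hg : ∀ t ∈ Icc 0 δ, HasDerivWithinAt g (vectorField hα.le hW (g t)) (Icc 0 δ) t) :
    IsSolution α σ δ (physical (zero_lt_one.trans hα).le σ (g 0))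
      (fun t => physical (zero_lt_one.trans hα).le σ (g t)) where
  initial := rfl
  real_valued := fun t ht => by
    -- The reflected conjugate curve solves the same equation with the same initial value, so
    -- uniqueness makes it equal to g.
    have h1 : ∀ t ∈ Icc 0 δ, HasDerivWithinAt (fun s => conjNeg (g s))
        (vectorField hα.le hW (conjNeg (g t))) (Icc 0 δ) t := fun t ht => by
      rw [← conjNeg_vectorField]
      exact conjNeg.hasFDerivAt.comp_hasDerivWithinAt t (hg t ht)
    exact (isRealValued_physical_iff hα σ (g t)).2 (eqOn_of_vectorField hα.le hW h1 hg h0 ht)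
  mem := fun t _ => opIMemHs_physical _ σ (g t)
  cont := fun t ht => by
    simp only [normHs_opI_physical_sub]
    have h1 := tendsto_iff_norm_sub_tendsto_zero.1 (hg t ht).continuousWithinAt.tendsto
    simpa using h1.const_mul (Real.sqrt (2 * Real.pi))
  equation := fun t ht =>
    (solvesAt_iff hα hσ hW rfl).2 (hasDerivWithinAt_physical _ σ (hg t ht))

/-- Local well-posedness on a time interval whose length does not depend on `σ`. -/
theorem exists_solution (hα : 1 < α) (hσ : 0 < σ) (hW : IsConvWeight (weight α σ) C)
    {u₀ : L2} (hr : IsRealValued u₀) (hu₀ : OpIMemHs σ (α / 2) u₀) (hδ : 0 < δ)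
    (hsmall : 4 * C * (δ * normHs (α / 2) (opI σ u₀)) ≤ Real.sqrt (2 * Real.pi)) :
    ∃ u : ℝ → L2, IsSolution α σ δ u₀ u ∧ LocalBound α σ δ u₀ u ∧
      ∀ v : ℝ → L2, IsSolution α σ δ u₀ v → EqOn v u (Icc 0 δ) := by
  have hα0 := (zero_lt_one.trans hα).le
  have hs : 0 < Real.sqrt (2 * Real.pi) := Real.sqrt_pos.2 (by positivity)
  have h0 : (0 : ℝ) ∈ Icc 0 δ := ⟨le_rfl, hδ.le⟩
  obtain ⟨x₀, rfl⟩ := exists_physical_eq hα0 hu₀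
  rw [normHs_opI_physical] at hsmall
  obtain ⟨g, hg0, hgb, hgd⟩ := exists_hasDerivWithinAt_quadratic
    (mulOp_mem_skewAdjoint (isBddSymbol_evSymbol hα.le) (conj_evSymbol α)) hW.nonneg
    (norm_quadOp_le hα.le hW) x₀ hδ.le (by
      have : 4 * C * (δ * ‖x₀‖) * Real.sqrt (2 * Real.pi) ≤ 1 * Real.sqrt (2 * Real.pi) := by
        linarith
      exact le_of_mul_le_mul_right this hs)
  have hx := (isRealValued_physical_iff hα σ x₀).1 hr
  have hsol := isSolution_physical hα hσ hW (by rw [hg0, hx]) hgd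
  rw [hg0] at hsol
  refine ⟨_, hsol, fun t ht => ?_, fun v hv => ?_⟩
  · rw [normHs_opI_physical, normHs_opI_physical]
    have := mul_le_mul_of_nonneg_left (hgb t ht) hs.le
    linarith
  · obtain ⟨k, hk, -, hkd⟩ := hv.exists_curve hα hσ hW
    have e0 : k 0 = g 0 := by
      apply physical_injective hα0 σ
      rw [hk 0 h0, hv.initial, hg0]
    have e := eqOn_of_vectorField hα.le hW hkd hgd e0
    intro t ht
    rw [← hk t ht, e ht]

end WellPosed

/-! ### Trilinear estimates with homogeneous kernels -/

section Trilinear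

/-- The trilinear integral `∫∫ k(x, y) |g(x)| |g(y)| |g(x - y)|`. -/
noncomputable def triIntegral (k : ℝ → ℝ → ℝ≥0∞) (g : L2) : ℝ≥0∞ :=
  ∫⁻ x, ∫⁻ y, k x y * (‖g x‖ₑ * ‖g y‖ₑ * ‖g (x - y)‖ₑ)

theorem triIntegral_mono {k k' : ℝ → ℝ → ℝ≥0∞} (h : ∀ x y, k x y ≤ k' x y) (g : L2) :
    triIntegral k g ≤ triIntegral k' g :=
  lintegral_mono fun x => lintegral_mono fun y => by gcongr; exact h x y

theorem aemeasurable_enorm_fst (g : L2) :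
    AEMeasurable (fun p : ℝ × ℝ => ‖g p.1‖ₑ) (volume.prod volume) :=
  (Lp.memLp g).1.enorm.comp_quasiMeasurePreserving Measure.quasiMeasurePreserving_fst

theorem aemeasurable_enorm_snd (g : L2) :
    AEMeasurable (fun p : ℝ × ℝ => ‖g p.2‖ₑ) (volume.prod volume) :=
  (Lp.memLp g).1.enorm.comp_quasiMeasurePreserving Measure.quasiMeasurePreserving_snd

theorem aemeasurable_enorm_sub (g : L2) :
    AEMeasurable (fun p : ℝ × ℝ => ‖g (p.1 - p.2)‖ₑ) (volume.prod volume) :=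
  (Lp.memLp g).1.enorm.comp_quasiMeasurePreserving (quasiMeasurePreserving_sub volume volume)

theorem aemeasurable_enorm_snd_sub (g : L2) :
    AEMeasurable (fun p : ℝ × ℝ => ‖g p.2‖ₑ * ‖g (p.1 - p.2)‖ₑ) (volume.prod volume) :=
  (aemeasurable_enorm_snd g).mul (aemeasurable_enorm_sub g)

theorem aemeasurable_enorm_fst_sub (g : L2) :
    AEMeasurable (fun p : ℝ × ℝ => ‖g p.1‖ₑ * ‖g (p.1 - p.2)‖ₑ) (volume.prod volume) :=
  (aemeasurable_enorm_fst g).mul (aemeasurable_enorm_sub g)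

theorem aemeasurable_triIntegrand {k : ℝ → ℝ → ℝ≥0∞} (hk : Measurable (Function.uncurry k))
    (g : L2) : AEMeasurable (fun p : ℝ × ℝ => k p.1 p.2 * (‖g p.1‖ₑ * ‖g p.2‖ₑ * ‖g (p.1 - p.2)‖ₑ))
      (volume.prod volume) :=
  hk.aemeasurable.mul (((aemeasurable_enorm_fst g).mul (aemeasurable_enorm_snd g)).mul
    (aemeasurable_enorm_sub g))

theorem triIntegral_eq_prod {k : ℝ → ℝ → ℝ≥0∞} (hk : Measurable (Function.uncurry k)) (g : L2) :
    triIntegral k g = ∫⁻ p : ℝ × ℝ, k p.1 p.2 * (‖g p.1‖ₑ * ‖g p.2‖ₑ * ‖g (p.1 - p.2)‖ₑ)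
      ∂(volume.prod volume) :=
  (lintegral_prod _ (aemeasurable_triIntegrand hk g)).symm

theorem triIntegral_add {k k' : ℝ → ℝ → ℝ≥0∞} (hk : Measurable (Function.uncurry k))
    (hk' : Measurable (Function.uncurry k')) (g : L2) :
    triIntegral (fun x y => k x y + k' x y) g = triIntegral k g + triIntegral k' g := by
  have hkk : Measurable (Function.uncurry fun x y => k x y + k' x y) := hk.add hk'
  rw [triIntegral_eq_prod hkk, triIntegral_eq_prod hk, triIntegral_eq_prod hk',
    ← lintegral_add_left' (aemeasurable_triIntegrand hk g)]
  simp only [add_mul]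

theorem triIntegral_const_mul {c : ℝ≥0∞} (hc : c ≠ ∞) (k : ℝ → ℝ → ℝ≥0∞) (g : L2) :
    triIntegral (fun x y => c * k x y) g = c * triIntegral k g := by
  unfold triIntegral
  simp only [mul_assoc]
  simp_rw [lintegral_const_mul' c _ hc]

theorem lintegral_prod_enorm_snd_sub (g : L2) :
    ∫⁻ p : ℝ × ℝ, (‖g p.2‖ₑ * ‖g (p.1 - p.2)‖ₑ) ^ 2 ∂(volume.prod volume) =
      ENNReal.ofReal ((‖g‖ * ‖g‖) ^ 2) := by
  rw [lintegral_prod _ ((aemeasurable_enorm_snd_sub g).pow_const 2)]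
  exact lintegral_lintegral_sq_mul_sq g g

theorem lintegral_prod_enorm_fst_sub (g : L2) :
    ∫⁻ p : ℝ × ℝ, (‖g p.1‖ₑ * ‖g (p.1 - p.2)‖ₑ) ^ 2 ∂(volume.prod volume) =
      ENNReal.ofReal ((‖g‖ * ‖g‖) ^ 2) := by
  rw [lintegral_prod _ ((aemeasurable_enorm_fst_sub g).pow_const 2)]
  have : ∀ x, ∫⁻ y, (‖g x‖ₑ * ‖g (x - y)‖ₑ) ^ 2 = ‖g x‖ₑ ^ 2 * ENNReal.ofReal (‖g‖ ^ 2) := by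
    intro x
    simp_rw [mul_pow]
    rw [lintegral_const_mul' _ _ (ENNReal.pow_ne_top enorm_ne_top),
      lintegral_sub_left_eq_self (fun y => ‖g y‖ₑ ^ 2) x, lintegral_enorm_sq_coeFn]
  simp_rw [this]
  rw [lintegral_mul_const' _ _ ENNReal.ofReal_ne_top, lintegral_enorm_sq_coeFn,
    ← ENNReal.ofReal_mul (by positivity), mul_pow]

theorem le_ofReal_of_sq_le {a : ℝ≥0∞} {K M : ℝ} (hK : 0 ≤ K) (hM : 0 ≤ M)
    (h : a ^ 2 ≤ ENNReal.ofReal (K ^ 2) * ENNReal.ofReal (M ^ 2) * ENNReal.ofReal ((M * M) ^ 2)) :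
    a ≤ ENNReal.ofReal (K * M ^ 3) := by
  rw [← ENNReal.ofReal_mul (by positivity), ← ENNReal.ofReal_mul (by positivity)] at h
  have e : K ^ 2 * M ^ 2 * (M * M) ^ 2 = (K * M ^ 3) ^ 2 := by ring
  rw [e, ENNReal.ofReal_pow (by positivity)] at h
  exact (ENNReal.pow_right_strictMono two_ne_zero).le_iff_le.1 h

/-- Schur type bound: integration in the second variable. -/
theorem triIntegral_le_of_right {k : ℝ → ℝ → ℝ≥0∞} (hk : Measurable (Function.uncurry k)) {K : ℝ}
    (hK : 0 ≤ K) (h : ∀ x, ∫⁻ y, k x y ^ 2 ≤ ENNReal.ofReal (K ^ 2)) (g : L2) :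
    triIntegral k g ≤ ENNReal.ofReal (K * ‖g‖ ^ 3) := by
  apply le_ofReal_of_sq_le hK (norm_nonneg g)
  rw [triIntegral_eq_prod hk]
  -- Cauchy–Schwarz on the plane: the kernel goes with the variable held fixed in `h`, and the other
  -- two factors have L² norm ‖g‖².
  have e : ∀ p : ℝ × ℝ, k p.1 p.2 * (‖g p.1‖ₑ * ‖g p.2‖ₑ * ‖g (p.1 - p.2)‖ₑ) =
      (k p.1 p.2 * ‖g p.1‖ₑ) * (‖g p.2‖ₑ * ‖g (p.1 - p.2)‖ₑ) := fun p => by ring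
  simp_rw [e]
  have hm : AEMeasurable (fun p : ℝ × ℝ => k p.1 p.2 * ‖g p.1‖ₑ) (volume.prod volume) :=
    hk.aemeasurable.mul (aemeasurable_enorm_fst g)
  refine (lintegral_mul_sq_le _ hm (aemeasurable_enorm_snd_sub g)).trans ?_
  rw [lintegral_prod_enorm_snd_sub]
  gcongr
  rw [lintegral_prod _ (hm.pow_const 2)]
  calc ∫⁻ x, ∫⁻ y, (k x y * ‖g x‖ₑ) ^ 2
      = ∫⁻ x, (∫⁻ y, k x y ^ 2) * ‖g x‖ₑ ^ 2 := by
        refine lintegral_congr fun x => ?_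
        simp_rw [mul_pow]
        rw [lintegral_mul_const' _ _ (ENNReal.pow_ne_top enorm_ne_top)]
    _ ≤ ∫⁻ x, ENNReal.ofReal (K ^ 2) * ‖g x‖ₑ ^ 2 :=
        lintegral_mono fun x => by gcongr; exact h x
    _ = _ := by
        rw [lintegral_const_mul' _ _ ENNReal.ofReal_ne_top, lintegral_enorm_sq_coeFn]

/-- Schur type bound: integration in the first variable. -/
theorem triIntegral_le_of_left {k : ℝ → ℝ → ℝ≥0∞} (hk : Measurable (Function.uncurry k)) {K : ℝ}
    (hK : 0 ≤ K) (h : ∀ y, ∫⁻ x, k x y ^ 2 ≤ ENNReal.ofReal (K ^ 2)) (g : L2) :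
    triIntegral k g ≤ ENNReal.ofReal (K * ‖g‖ ^ 3) := by
  apply le_ofReal_of_sq_le hK (norm_nonneg g)
  rw [triIntegral_eq_prod hk]
  have e : ∀ p : ℝ × ℝ, k p.1 p.2 * (‖g p.1‖ₑ * ‖g p.2‖ₑ * ‖g (p.1 - p.2)‖ₑ) =
      (k p.1 p.2 * ‖g p.2‖ₑ) * (‖g p.1‖ₑ * ‖g (p.1 - p.2)‖ₑ) := fun p => by ring
  simp_rw [e]
  have hm : AEMeasurable (fun p : ℝ × ℝ => k p.1 p.2 * ‖g p.2‖ₑ) (volume.prod volume) :=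
    hk.aemeasurable.mul (aemeasurable_enorm_snd g)
  refine (lintegral_mul_sq_le _ hm (aemeasurable_enorm_fst_sub g)).trans ?_
  rw [lintegral_prod_enorm_fst_sub]
  gcongr
  rw [lintegral_prod_symm _ (hm.pow_const 2)]
  calc ∫⁻ y, ∫⁻ x, (k x y * ‖g y‖ₑ) ^ 2
      = ∫⁻ y, (∫⁻ x, k x y ^ 2) * ‖g y‖ₑ ^ 2 := by
        refine lintegral_congr fun y => ?_
        simp_rw [mul_pow]
        rw [lintegral_mul_const' _ _ (ENNReal.pow_ne_top enorm_ne_top)]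
    _ ≤ ∫⁻ y, ENNReal.ofReal (K ^ 2) * ‖g y‖ₑ ^ 2 :=
        lintegral_mono fun y => by gcongr; exact h y
    _ = _ := by
        rw [lintegral_const_mul' _ _ ENNReal.ofReal_ne_top, lintegral_enorm_sq_coeFn]

theorem setLIntegral_abs_rpow {r : ℝ} (hr : r < 1) {B : ℝ} (hB : 0 ≤ B) :
    ∫⁻ a in Icc (-B) B, ENNReal.ofReal (|a| ^ (-r)) ≤
      ENNReal.ofReal (2 * (B ^ (1 - r) / (1 - r))) := by
  have h1 : ∫⁻ a in Icc 0 B, ENNReal.ofReal (|a| ^ (-r)) =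
      ENNReal.ofReal (B ^ (1 - r) / (1 - r)) := by
    have hi := intervalIntegral.intervalIntegrable_rpow' (a := 0) (b := B) (r := -r) (by linarith)
    rw [intervalIntegrable_iff_integrableOn_Ioc_of_le hB] at hi
    have hv := integral_rpow (a := 0) (b := B) (r := -r) (Or.inl (by linarith))
    rw [intervalIntegral.integral_of_le hB, Real.zero_rpow (by linarith), sub_zero,
      neg_add_eq_sub] at hv
    rw [← hv, ofReal_integral_eq_lintegral_ofReal hi, setLIntegral_congr Ioc_ae_eq_Icc.symm]
    · exact setLIntegral_congr_fun measurableSet_Ioc fun a ha => by rw [abs_of_pos ha.1]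
    · exact (ae_restrict_iff' measurableSet_Ioc).2
        (Eventually.of_forall fun a ha => Real.rpow_nonneg ha.1.le _)
  have h2 : ∫⁻ a in Icc (-B) 0, ENNReal.ofReal (|a| ^ (-r)) =
      ∫⁻ a in Icc 0 B, ENNReal.ofReal (|a| ^ (-r)) := by
    have := measurePreserving_neg_real.setLIntegral_comp_preimage (s := Icc 0 B)
      measurableSet_Icc (f := fun a => ENNReal.ofReal (|a| ^ (-r))) (by fun_prop)
    rw [← this]
    simp
  rw [← Icc_union_Icc_eq_Icc (neg_nonpos.2 hB) hB]
  refine (lintegral_union_le _ _ _).trans ?_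
  have h3 : 0 ≤ B ^ (1 - r) / (1 - r) :=
    div_nonneg (Real.rpow_nonneg hB _) (by linarith)
  rw [h2, h1, ← ENNReal.ofReal_add h3 h3, two_mul]

/-- The homogeneous kernel `|a|^{-r/2} |b|^{(r-1)/2}` on `|a| ≤ |b|`. -/
noncomputable def homKernel (r a b : ℝ) : ℝ≥0∞ :=
  if |a| ≤ |b| then ENNReal.ofReal (|a| ^ (-(r / 2)) * |b| ^ ((r - 1) / 2)) else 0

theorem measurable_homKernel (r : ℝ) : Measurable (Function.uncurry (homKernel r)) := by
  unfold homKernel Function.uncurry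
  refine Measurable.ite (measurableSet_le (by fun_prop) (by fun_prop)) (by fun_prop) (by fun_prop)

/-- The squared kernel is homogeneous of degree -1, so its integral in a does not depend on b ≠ 0.
The cutoff |a| ≤ |b| and r < 1 make it finite. -/
theorem lintegral_homKernel_sq {r : ℝ} (hr : r < 1) (b : ℝ) :
    ∫⁻ a, homKernel r a b ^ 2 ≤ ENNReal.ofReal (Real.sqrt (2 / (1 - r)) ^ 2) := by
  have hr' : 0 < 1 - r := by linarith
  have hsq : ∀ x : ℝ, 0 ≤ x → ∀ s : ℝ, (x ^ (s / 2)) ^ 2 = x ^ s := fun x hx s => by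
    rw [← Real.rpow_natCast, ← Real.rpow_mul hx]; norm_num
  have e : ∀ a, homKernel r a b ^ 2 = (Icc (-|b|) |b|).indicator
      (fun a => ENNReal.ofReal (|b| ^ (r - 1)) * ENNReal.ofReal (|a| ^ (-r))) a := fun a => by
    unfold homKernel indicator
    simp only [mem_Icc, ← abs_le]
    split_ifs with h
    · rw [← ENNReal.ofReal_mul (by positivity), ← ENNReal.ofReal_pow (by positivity), mul_pow,
        hsq _ (abs_nonneg b), ← neg_div, hsq _ (abs_nonneg a), mul_comm]
    · simp
  simp_rw [e]
  rw [lintegral_indicator measurableSet_Icc, lintegral_const_mul' _ _ ENNReal.ofReal_ne_top,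
    Real.sq_sqrt (by positivity)]
  refine (mul_le_mul_right (setLIntegral_abs_rpow hr (abs_nonneg b)) _).trans ?_
  rw [← ENNReal.ofReal_mul (by positivity)]
  apply ENNReal.ofReal_le_ofReal
  rcases eq_or_ne b 0 with rfl | hb
  · rw [abs_zero, Real.zero_rpow (by linarith)]
    simp only [zero_mul]
    positivity
  · have hb' : 0 < |b| := abs_pos.2 hb
    have : |b| ^ (r - 1) * |b| ^ (1 - r) = 1 := by
      rw [← Real.rpow_add hb']; simp
    apply le_of_eq
    calc _ = (|b| ^ (r - 1) * |b| ^ (1 - r)) * (2 / (1 - r)) := by ring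
      _ = _ := by rw [this, one_mul]

theorem rpow_neg_le_of_le_two_mul {p a b : ℝ} (hp : 0 < p) (hp' : p ≤ 1) (ha : 0 < a)
    (hab : a ≤ 2 * b) : b ^ (-p) ≤ 2 * a ^ (-p) := by
  have hb : 0 < b := by linarith
  have h1 : a ^ p ≤ (2 * b) ^ p := Real.rpow_le_rpow ha.le hab hp.le
  rw [Real.mul_rpow zero_le_two hb.le] at h1
  have h2 : (2 : ℝ) ^ p ≤ 2 := by
    simpa using Real.rpow_le_rpow_of_exponent_le one_le_two hp'
  rw [Real.rpow_neg ha.le, Real.rpow_neg hb.le]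
  have pa := Real.rpow_pos_of_pos ha p
  have pb := Real.rpow_pos_of_pos hb p
  rw [← div_eq_mul_inv, le_div_iff₀ pa, inv_mul_le_iff₀ pb]
  nlinarith

/-- Of x, y, x - y, the two larger in modulus are comparable within a factor 2. Merging their powers
leaves a kernel in the smallest variable and one other, and 2p+q = 1/2 gives it the degree -1/2 of
`homKernel`. -/
theorem homogeneous_le {p q : ℝ} (hp : 0 < p) (hp' : p < 1 / 2) (hpq : 2 * p + q = 1 / 2)
    (x y : ℝ) : ENNReal.ofReal (|x| ^ (-q) * |y| ^ (-p) * |x - y| ^ (-p)) ≤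
      2 * (homKernel (2 * p) y x + homKernel (2 * p) (x - y) x + homKernel (2 * q) x y) := by
  rcases eq_or_ne y 0 with rfl | hy
  -- As p ≠ 0, the convention 0^{-p} = 0 makes the left side vanish on this line.
  · rw [abs_zero, Real.zero_rpow (by linarith)]; simp
  rcases eq_or_ne (x - y) 0 with hz | hz
  · rw [hz, abs_zero, Real.zero_rpow (by linarith)]; simp
  have hy' : 0 < |y| := abs_pos.2 hy
  have hz' : 0 < |x - y| := abs_pos.2 hz
  have t1 : |x| ≤ |y| + |x - y| := by
    have := abs_add_le y (x - y); rwa [add_sub_cancel] at this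
  have t2 : |y| ≤ |x| + |x - y| := by
    have := abs_sub x (x - y)
    rwa [sub_sub_cancel] at this
  have two : (2 : ℝ≥0∞) = ENNReal.ofReal 2 := by simp
  have q1 : (2 * p - 1) / 2 = -q + -p := by linarith
  have q2 : (2 * q - 1) / 2 = -p + -p := by linarith
  have q3 : -(2 * p / 2) = -p := by ring
  have q4 : -(2 * q / 2) = -q := by ring
  have nx : 0 ≤ |x| ^ (-q) := Real.rpow_nonneg (abs_nonneg x) _
  have ny : 0 ≤ |y| ^ (-p) := Real.rpow_nonneg (abs_nonneg y) _
  have nz : 0 ≤ |x - y| ^ (-p) := Real.rpow_nonneg (abs_nonneg _) _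
  by_cases h1 : |x| ≤ |y| ∧ |x| ≤ |x - y|
  · have hk : ENNReal.ofReal (|x| ^ (-q) * |y| ^ (-p) * |x - y| ^ (-p)) ≤
        2 * homKernel (2 * q) x y := by
      rw [homKernel, if_pos h1.1, two, ← ENNReal.ofReal_mul zero_le_two, q2, q4,
        Real.rpow_add hy']
      apply ENNReal.ofReal_le_ofReal
      have := rpow_neg_le_of_le_two_mul hp (by linarith) hy'
        (by linarith [h1.2] : |y| ≤ 2 * |x - y|)
      calc _ ≤ |x| ^ (-q) * |y| ^ (-p) * (2 * |y| ^ (-p)) := by gcongr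
        _ = _ := by ring
    refine hk.trans ?_
    gcongr
    exact le_add_self
  by_cases h2 : |y| ≤ |x - y|
  · have hyx : |y| ≤ |x| := by
      by_contra hc
      push Not at hc
      exact h1 ⟨hc.le, hc.le.trans h2⟩
    have hk : ENNReal.ofReal (|x| ^ (-q) * |y| ^ (-p) * |x - y| ^ (-p)) ≤
        2 * homKernel (2 * p) y x := by
      rw [homKernel, if_pos hyx, two, ← ENNReal.ofReal_mul zero_le_two, q1, q3,
        Real.rpow_add (hy'.trans_le hyx)]
      apply ENNReal.ofReal_le_ofReal
      have := rpow_neg_le_of_le_two_mul hp (by linarith) (hy'.trans_le hyx)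
        (by linarith : |x| ≤ 2 * |x - y|)
      calc _ ≤ |x| ^ (-q) * |y| ^ (-p) * (2 * |x| ^ (-p)) := by gcongr
        _ = _ := by ring
    refine hk.trans ?_
    gcongr
    rw [add_assoc]
    exact le_self_add
  · push Not at h2
    have hzx : |x - y| ≤ |x| := by
      by_contra hc
      push Not at hc
      exact h1 ⟨hc.le.trans h2.le, hc.le⟩
    have hk : ENNReal.ofReal (|x| ^ (-q) * |y| ^ (-p) * |x - y| ^ (-p)) ≤
        2 * homKernel (2 * p) (x - y) x := by
      rw [homKernel, if_pos hzx, two, ← ENNReal.ofReal_mul zero_le_two, q1, q3,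
        Real.rpow_add (hz'.trans_le hzx)]
      apply ENNReal.ofReal_le_ofReal
      have := rpow_neg_le_of_le_two_mul hp (by linarith) (hz'.trans_le hzx)
        (by linarith : |x| ≤ 2 * |y|)
      calc _ ≤ |x| ^ (-q) * (2 * |x| ^ (-p)) * |x - y| ^ (-p) := by gcongr
        _ = _ := by ring
    refine hk.trans ?_
    gcongr
    rw [add_right_comm]
    exact le_add_self

/-- The trilinear estimate with homogeneous weights at the scaling critical exponents. -/
theorem triIntegral_homogeneous_le {p q : ℝ} (hp : 0 < p) (hp' : p < 1 / 2)
    (hpq : 2 * p + q = 1 / 2) : ∃ K : ℝ, 0 ≤ K ∧ ∀ g : L2,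
      triIntegral (fun x y => ENNReal.ofReal (|x| ^ (-q) * |y| ^ (-p) * |x - y| ^ (-p))) g ≤
        ENNReal.ofReal (K * ‖g‖ ^ 3) := by
  set K₁ := Real.sqrt (2 / (1 - 2 * p))
  set K₂ := Real.sqrt (2 / (1 - 2 * q))
  refine ⟨2 * (K₁ + K₁ + K₂), by positivity, fun g => ?_⟩
  have m1 : Measurable (Function.uncurry fun x y : ℝ => homKernel (2 * p) y x) :=
    (measurable_homKernel (2 * p)).comp measurable_swap
  have m2 : Measurable (Function.uncurry fun x y : ℝ => homKernel (2 * p) (x - y) x) :=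
    (measurable_homKernel (2 * p)).comp
      (by fun_prop : Measurable fun z : ℝ × ℝ => (z.1 - z.2, z.1))
  have m3 : Measurable (Function.uncurry fun x y : ℝ => homKernel (2 * q) x y) :=
    measurable_homKernel (2 * q)
  have b1 := triIntegral_le_of_right m1 (Real.sqrt_nonneg _)
    (fun x => lintegral_homKernel_sq (r := 2 * p) (by linarith) x) g
  have b2 := triIntegral_le_of_right m2 (Real.sqrt_nonneg _)
    (fun x => by
      rw [lintegral_sub_left_eq_self (fun y => homKernel (2 * p) y x ^ 2) x]
      exact lintegral_homKernel_sq (r := 2 * p) (by linarith) x) g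
  have b3 := triIntegral_le_of_left m3 (Real.sqrt_nonneg _)
    (fun y => lintegral_homKernel_sq (r := 2 * q) (by linarith) y) g
  have m12 : Measurable (Function.uncurry fun x y : ℝ =>
      homKernel (2 * p) y x + homKernel (2 * p) (x - y) x) := m1.add m2
  refine (triIntegral_mono (homogeneous_le hp hp' hpq) g).trans ?_
  rw [triIntegral_const_mul (by simp), triIntegral_add m12 m3, triIntegral_add m1 m2]
  refine (mul_le_mul_right (add_le_add (add_le_add b1 b2) b3) _).trans (le_of_eq ?_)
  rw [← ENNReal.ofReal_add (by positivity) (by positivity),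
    ← ENNReal.ofReal_add (by positivity) (by positivity)]
  have two : ∀ z : ℝ, 2 * ENNReal.ofReal z = ENNReal.ofReal (2 * z) := fun z => by
    rw [ENNReal.ofReal_mul zero_le_two]; simp
  rw [two]
  congr 1
  ring

end Trilinear

/-! ### The cubic flux and its cancellation -/

section Flux

variable {α σ : ℝ}

/-- The Fourier transform of `I u`, for `u` with Fourier variable `g`. -/
noncomputable def lowered (α : ℝ) (g : L2) (η : ℝ) : ℂ := ((jap η ^ (-(α / 2)) : ℝ) : ℂ) * g η

/-- The integrand of `-Re ∫ I u ∂ₓ (I u)²` on the Fourier side. -/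
noncomputable def flux (α : ℝ) (g : L2) (p : ℝ × ℝ) : ℂ :=
  -Complex.I * ((2 * Real.pi * p.1 : ℝ) : ℂ) *
    ((starRingEnd ℂ) (lowered α g p.1) * lowered α g p.2 * lowered α g (p.1 - p.2))

/-- The kernel of the modulus of `flux`. -/
noncomputable def fluxKernel (α x y : ℝ) : ℝ :=
  |2 * Real.pi * x| * jap x ^ (-(α / 2)) * jap y ^ (-(α / 2)) * jap (x - y) ^ (-(α / 2))

theorem jap_rpow_nonneg (η s : ℝ) : 0 ≤ jap η ^ s := (Real.rpow_pos_of_pos (jap_pos η) s).le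

theorem fluxKernel_nonneg (α x y : ℝ) : 0 ≤ fluxKernel α x y := by
  have := jap_rpow_nonneg x (-(α / 2))
  have := jap_rpow_nonneg y (-(α / 2))
  have := jap_rpow_nonneg (x - y) (-(α / 2))
  unfold fluxKernel
  positivity

theorem measurable_fluxKernel (α : ℝ) : Measurable (Function.uncurry (fluxKernel α)) := by
  unfold fluxKernel Function.uncurry jap
  fun_prop

theorem measurable_ofReal_fluxKernel (α : ℝ) :
    Measurable (Function.uncurry fun x y => ENNReal.ofReal (fluxKernel α x y)) :=
  (measurable_fluxKernel α).ennreal_ofReal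

theorem enorm_lowered (α : ℝ) (g : L2) (η : ℝ) :
    ‖lowered α g η‖ₑ = ENNReal.ofReal (jap η ^ (-(α / 2))) * ‖g η‖ₑ := by
  rw [lowered, enorm_mul, ← ofReal_norm (((jap η ^ (-(α / 2)) : ℝ) : ℂ)), Complex.norm_real,
    Real.norm_of_nonneg (jap_rpow_nonneg _ _)]

theorem enorm_flux (α : ℝ) (g : L2) (p : ℝ × ℝ) :
    ‖flux α g p‖ₑ = ENNReal.ofReal (fluxKernel α p.1 p.2) *
      (‖g p.1‖ₑ * ‖g p.2‖ₑ * ‖g (p.1 - p.2)‖ₑ) := by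
  have h1 : ‖-Complex.I * ((2 * Real.pi * p.1 : ℝ) : ℂ)‖ₑ = ENNReal.ofReal |2 * Real.pi * p.1| := by
    rw [← ofReal_norm, norm_mul, norm_neg, Complex.norm_I, one_mul, Complex.norm_real,
      Real.norm_eq_abs]
  have h2 : ‖(starRingEnd ℂ) (lowered α g p.1)‖ₑ = ‖lowered α g p.1‖ₑ := by
    rw [← ofReal_norm, ← ofReal_norm, RCLike.norm_conj]
  have n1 := jap_rpow_nonneg p.1 (-(α / 2))
  have n2 := jap_rpow_nonneg p.2 (-(α / 2))
  unfold flux fluxKernel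
  rw [enorm_mul, h1, enorm_mul, enorm_mul, h2, enorm_lowered, enorm_lowered, enorm_lowered,
    ENNReal.ofReal_mul (by positivity), ENNReal.ofReal_mul (by positivity),
    ENNReal.ofReal_mul (by positivity)]
  ring

theorem jap_sqrt_le (x y : ℝ) :
    jap x ^ (1 / 2 : ℝ) ≤ jap y ^ (1 / 2 : ℝ) + jap (x - y) ^ (1 / 2 : ℝ) :=
  (Real.rpow_le_rpow (jap_pos x).le (jap_le_add x y) (by norm_num)).trans
    (Real.rpow_add_le_add_rpow (jap_pos y).le (jap_pos _).le (by norm_num) (by norm_num))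

/-- After using the weight at x, at most half a derivative is left since 1 - α/2 ≤ 1/2. The
subadditive square root passes it to y or x - y, where the weight absorbs it. -/
theorem fluxKernel_le (hα : 1 < α) (x y : ℝ) :
    fluxKernel α x y ≤ jap y ^ (-(α / 2)) + jap (x - y) ^ (-(α / 2)) := by
  have ny := jap_rpow_nonneg y (-(α / 2))
  have nz := jap_rpow_nonneg (x - y) (-(α / 2))
  have h1 : |2 * Real.pi * x| * jap x ^ (-(α / 2)) ≤ jap x ^ (1 / 2 : ℝ) := by
    have e : jap x ^ (1 - α / 2) = jap x * jap x ^ (-(α / 2)) := by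
      rw [sub_eq_add_neg, Real.rpow_add (jap_pos x), Real.rpow_one]
    calc |2 * Real.pi * x| * jap x ^ (-(α / 2)) ≤ jap x * jap x ^ (-(α / 2)) := by
          have := jap_rpow_nonneg x (-(α / 2))
          gcongr
          unfold jap; linarith
      _ = jap x ^ (1 - α / 2) := e.symm
      _ ≤ _ := Real.rpow_le_rpow_of_exponent_le (one_le_jap x) (by linarith)
  have h2 : ∀ z, jap z ^ (1 / 2 : ℝ) * jap z ^ (-(α / 2)) ≤ 1 := fun z => by
    rw [← Real.rpow_add (jap_pos z)]
    exact Real.rpow_le_one_of_one_le_of_nonpos (one_le_jap z) (by linarith)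
  unfold fluxKernel
  calc |2 * Real.pi * x| * jap x ^ (-(α / 2)) * jap y ^ (-(α / 2)) * jap (x - y) ^ (-(α / 2))
      ≤ (jap y ^ (1 / 2 : ℝ) + jap (x - y) ^ (1 / 2 : ℝ)) * jap y ^ (-(α / 2)) *
        jap (x - y) ^ (-(α / 2)) := by
          gcongr
          exact h1.trans (jap_sqrt_le x y)
    _ = (jap y ^ (1 / 2 : ℝ) * jap y ^ (-(α / 2))) * jap (x - y) ^ (-(α / 2)) +
        (jap (x - y) ^ (1 / 2 : ℝ) * jap (x - y) ^ (-(α / 2))) * jap y ^ (-(α / 2)) := by ring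
    _ ≤ 1 * jap (x - y) ^ (-(α / 2)) + 1 * jap y ^ (-(α / 2)) := by
        gcongr
        · exact h2 y
        · exact h2 (x - y)
    _ = _ := by ring

/-- A qualitative bound that legitimises Fubini and the splitting of the cubic integral; the power
of σ comes from elsewhere. -/
theorem triIntegral_fluxKernel_lt_top (hα : 1 < α) (g : L2) :
    triIntegral (fun x y => ENNReal.ofReal (fluxKernel α x y)) g < ∞ := by
  set J := ∫ η, jap η ^ (-α)
  have hJ0 : 0 ≤ J := integral_nonneg fun η => jap_rpow_nonneg η _
  have hi := integrable_jap_rpow hα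
  refine (triIntegral_le_of_right (measurable_ofReal_fluxKernel α)
    (Real.sqrt_nonneg (2 * (J + J))) (fun x => ?_) g).trans_lt ENNReal.ofReal_lt_top
  have hi2 : Integrable fun y => jap (x - y) ^ (-α) := hi.comp_sub_left x
  have hsq : ∀ z, (jap z ^ (-(α / 2))) ^ 2 = jap z ^ (-α) := fun z => by
    rw [← jap_rpow_sq]; congr 1; ring
  rw [Real.sq_sqrt (by positivity)]
  calc ∫⁻ y, ENNReal.ofReal (fluxKernel α x y) ^ 2
      ≤ ∫⁻ y, ENNReal.ofReal (2 * (jap y ^ (-α) + jap (x - y) ^ (-α))) := by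
        refine lintegral_mono fun y => ?_
        rw [← ENNReal.ofReal_pow (fluxKernel_nonneg α x y)]
        apply ENNReal.ofReal_le_ofReal
        refine (pow_le_pow_left₀ (fluxKernel_nonneg α x y) (fluxKernel_le hα x y) 2).trans ?_
        rw [← hsq, ← hsq]
        exact add_sq_le
    _ = ENNReal.ofReal (∫ y, 2 * (jap y ^ (-α) + jap (x - y) ^ (-α))) := by
        refine (ofReal_integral_eq_lintegral_ofReal ((hi.add hi2).const_mul 2) ?_).symm
        exact Eventually.of_forall fun y =>
          mul_nonneg zero_le_two (add_nonneg (jap_rpow_nonneg y _) (jap_rpow_nonneg (x - y) _))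
    _ = _ := by
        rw [integral_const_mul, integral_add hi hi2,
          integral_sub_left_eq_self (fun y => jap y ^ (-α)) volume x]

theorem aestronglyMeasurable_lowered (α : ℝ) (g : L2) :
    AEStronglyMeasurable (lowered α g) volume :=
  (Complex.measurable_ofReal.comp (continuous_jap_rpow _).measurable).aestronglyMeasurable.mul
    (Lp.memLp g).1

theorem aestronglyMeasurable_flux (α : ℝ) (g : L2) :
    AEStronglyMeasurable (flux α g) (volume.prod volume) := by
  have h := aestronglyMeasurable_lowered α g
  have h1 : AEStronglyMeasurable (fun p : ℝ × ℝ => lowered α g p.1) (volume.prod volume) :=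
    h.comp_quasiMeasurePreserving Measure.quasiMeasurePreserving_fst
  have h2 : AEStronglyMeasurable (fun p : ℝ × ℝ => lowered α g p.2) (volume.prod volume) :=
    h.comp_quasiMeasurePreserving Measure.quasiMeasurePreserving_snd
  have h3 : AEStronglyMeasurable (fun p : ℝ × ℝ => lowered α g (p.1 - p.2))
      (volume.prod volume) :=
    h.comp_quasiMeasurePreserving (quasiMeasurePreserving_sub volume volume)
  have h0 : Measurable fun p : ℝ × ℝ => -Complex.I * ((2 * Real.pi * p.1 : ℝ) : ℂ) := by fun_prop
  exact h0.aestronglyMeasurable.mul ((h1.star.mul h2).mul h3)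

theorem integrable_flux (hα : 1 < α) (g : L2) : Integrable (flux α g) (volume.prod volume) := by
  refine ⟨aestronglyMeasurable_flux α g, ?_⟩
  have h := triIntegral_fluxKernel_lt_top hα g
  rw [triIntegral_eq_prod (measurable_ofReal_fluxKernel α)] at h
  unfold HasFiniteIntegral
  simpa only [enorm_flux] using h

/-- The cubic expression without commutator vanishes for real-valued functions. -/
theorem integral_flux_eq_zero (hα : 1 < α) {g : L2} (hg : conjNeg g = g) :
    ∫ p, flux α g p ∂(volume.prod volume) = 0 := by
  set v := lowered α g with hv
  have hsymm : ∀ᵐ x, (starRingEnd ℂ) (v x) = v (-x) := by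
    have h1 := coeFn_conjNeg g
    rw [hg] at h1
    filter_upwards [h1] with x hx
    simp only [hv, lowered, map_mul, Complex.conj_ofReal, jap_neg]
    rw [hx, Complex.conj_conj]
  set T : ℝ × ℝ → ℂ := fun p => v (-p.1) * v p.2 * v (p.1 - p.2) with hT
  set X : ℝ × ℝ → ℂ := fun p => (p.1 : ℂ) * T p with hX
  set Y : ℝ × ℝ → ℂ := fun p => (p.2 : ℂ) * T p with hY
  have hflux : flux α g =ᵐ[volume.prod volume] fun p => (-Complex.I * (2 * Real.pi : ℝ)) * X p := by
    filter_upwards [Measure.quasiMeasurePreserving_fst.ae hsymm] with p hp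
    simp only [flux, hX, hT]
    rw [← hv, hp]
    push_cast
    ring
  have hc : (-Complex.I * ((2 * Real.pi : ℝ) : ℂ)) ≠ 0 :=
    mul_ne_zero (neg_ne_zero.2 Complex.I_ne_zero) (Complex.ofReal_ne_zero.2 (by positivity))
  have iX : Integrable X (volume.prod volume) := by
    have h1 := ((integrable_flux hα g).congr hflux).const_mul
      (-Complex.I * ((2 * Real.pi : ℝ) : ℂ))⁻¹
    refine h1.congr (Eventually.of_forall fun p => ?_)
    exact inv_mul_cancel_left₀ hc _
  -- T is invariant under (x,y) ↦ (-y,-x), which exchanges X with -Y, and under y ↦ x - y, which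
  -- turns Y into X - Y. Hence ∫X = -∫Y and 2∫Y = ∫X, so both vanish.
  have hB : MeasurePreserving (fun p : ℝ × ℝ => (-p.2, -p.1)) (volume.prod volume)
      (volume.prod volume) :=
    (measurePreserving_neg_real.prod measurePreserving_neg_real).comp Measure.measurePreserving_swap
  have hBX : ∀ p : ℝ × ℝ, X (-p.2, -p.1) = -Y p := fun p => by
    simp only [hX, hY, hT]
    rw [neg_neg, neg_sub_neg]
    push_cast
    ring
  have iY : Integrable Y (volume.prod volume) := by
    have h1 := (hB.integrable_comp iX.aestronglyMeasurable).2 iX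
    refine h1.neg.congr (Eventually.of_forall fun p => ?_)
    simp only [Function.comp, Pi.neg_apply]
    rw [hBX, neg_neg]
  have e1 : ∫ p, X p ∂(volume.prod volume) = -∫ p, Y p ∂(volume.prod volume) := by
    have hme : MeasurableEmbedding (fun p : ℝ × ℝ => (-p.2, -p.1)) :=
      ((MeasurableEquiv.neg ℝ).prodCongr (MeasurableEquiv.neg ℝ)).measurableEmbedding.comp
        MeasurableEquiv.prodComm.measurableEmbedding
    rw [← hB.integral_comp hme, ← integral_neg]
    exact integral_congr_ae (Eventually.of_forall hBX)
  have e2 : ∫ p, Y p ∂(volume.prod volume) =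
      ∫ p, X p ∂(volume.prod volume) - ∫ p, Y p ∂(volume.prod volume) := by
    have hXY : Integrable (fun p => X p - Y p) (volume.prod volume) := iX.sub iY
    rw [← integral_sub iX iY, integral_prod _ iY, integral_prod _ hXY]
    congr 1
    ext x
    rw [← integral_sub_left_eq_self (fun y => Y (x, y)) volume x]
    congr 1
    ext y
    simp only [hX, hY, hT, sub_sub_cancel]
    push_cast
    ring
  rw [integral_congr_ae hflux, integral_const_mul]
  have hX0 : ∫ p, X p ∂(volume.prod volume) = 0 := by
    linear_combination (2 / 3) * e1 - (1 / 3) * e2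
  rw [hX0, mul_zero]

end Flux

/-! ### Bounds for the hyperbolic tangent -/

section Tanh

theorem abs_sinh_le_mul_cosh (x : ℝ) : |Real.sinh x| ≤ |x| * Real.cosh x := by
  have key : ∀ t : ℝ, 0 ≤ t → Real.sinh t ≤ t * Real.cosh t := fun t ht => by
    have hd : ∀ s : ℝ, HasDerivAt (fun s => s * Real.cosh s - Real.sinh s)
        (1 * Real.cosh s + s * Real.sinh s - Real.cosh s) s := fun s =>
      ((hasDerivAt_id s).mul (Real.hasDerivAt_cosh s)).sub (Real.hasDerivAt_sinh s)
    have hm : MonotoneOn (fun s => s * Real.cosh s - Real.sinh s) (Ici 0) := by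
      apply monotoneOn_of_deriv_nonneg (convex_Ici 0)
      · exact fun s _ => (hd s).continuousAt.continuousWithinAt
      · exact fun s _ => (hd s).differentiableAt.differentiableWithinAt
      · intro s hs
        rw [interior_Ici, mem_Ioi] at hs
        rw [(hd s).deriv]
        have := mul_nonneg hs.le (Real.sinh_nonneg_iff.2 hs.le)
        linarith
    have := hm (mem_Ici.2 le_rfl) (mem_Ici.2 ht) ht
    simp only [zero_mul, Real.sinh_zero, sub_zero] at this
    linarith
  rw [← Real.cosh_abs, Real.abs_sinh]
  exact key |x| (abs_nonneg x)

theorem abs_tanh_le_one (x : ℝ) : |Real.tanh x| ≤ 1 := by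
  rw [Real.tanh_eq_sinh_div_cosh, abs_div, abs_of_pos (Real.cosh_pos x), div_le_one (Real.cosh_pos x)]
  exact abs_sinh_le_cosh x

theorem abs_tanh_le_abs (x : ℝ) : |Real.tanh x| ≤ |x| := by
  rw [Real.tanh_eq_sinh_div_cosh, abs_div, abs_of_pos (Real.cosh_pos x), div_le_iff₀ (Real.cosh_pos x)]
  exact abs_sinh_le_mul_cosh x

/-- Interpolation between the bounds |x| near 0 and 1 at infinity. The requirement θ ≤ 1 is why β
stops growing at 2. -/
theorem abs_tanh_le_rpow {θ : ℝ} (h0 : 0 ≤ θ) (h1 : θ ≤ 1) (x : ℝ) :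
    |Real.tanh x| ≤ |x| ^ θ := by
  rcases le_total |x| 1 with h | h
  · refine (abs_tanh_le_abs x).trans ?_
    rcases eq_or_lt_of_le (abs_nonneg x) with h2 | h2
    · rw [← h2]; exact Real.rpow_nonneg le_rfl _
    · simpa using Real.rpow_le_rpow_of_exponent_ge h2 h h1
  · exact (abs_tanh_le_one x).trans (Real.one_le_rpow h h0)

end Tanh

open scoped InnerProductSpace

/-! ### The modified energy and its growth -/

section Energy

variable {α σ C δ : ℝ}

/-- The symbol of `D^{α/2}` composed with the Bessel potential of order `α / 2`. -/
noncomputable def highSymbol (α η : ℝ) : ℝ := |2 * Real.pi * η| ^ (α / 2) * jap η ^ (-(α / 2))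

theorem highSymbol_nonneg (α η : ℝ) : 0 ≤ highSymbol α η :=
  mul_nonneg (Real.rpow_nonneg (abs_nonneg _) _) (jap_rpow_nonneg _ _)

theorem highSymbol_le_one (hα : 0 ≤ α) (η : ℝ) : highSymbol α η ≤ 1 := by
  have h : |2 * Real.pi * η| ^ (α / 2) ≤ jap η ^ (α / 2) :=
    Real.rpow_le_rpow (abs_nonneg _) (by unfold jap; linarith) (by linarith)
  have h0 := Real.rpow_pos_of_pos (jap_pos η) (α / 2)
  rw [highSymbol, Real.rpow_neg (jap_pos η).le, ← div_eq_mul_inv, div_le_one h0]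
  exact h

theorem isBddSymbol_highSymbol (hα : 0 ≤ α) : IsBddSymbol fun η => (highSymbol α η : ℂ) :=
  isBddSymbol_ofReal (by unfold highSymbol jap; fun_prop) 1 zero_le_one fun η => by
    rw [abs_of_nonneg (highSymbol_nonneg α η)]; exact highSymbol_le_one hα η

theorem opD_bessel (hα : 0 ≤ α) (g : L2) :
    opD (α / 2) (bessel (α / 2) (div_nonneg hα zero_le_two) g) =
      𝓕⁻ (mulOp _ (isBddSymbol_highSymbol hα) g) :=
  multiplier_fourierInv_mulOp _ _ (fun η => by
    rw [dSymbol_eq, highSymbol, Complex.ofReal_mul]) g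

theorem norm_fourierInv_L2 (f : L2) : ‖(𝓕⁻ f : L2)‖ = ‖f‖ :=
  (Lp.fourierTransformₗᵢ ℝ ℂ).symm.norm_map f

theorem energy_physical (hα : 0 ≤ α) (σ : ℝ) (g : L2) :
    energy α σ (physical hα σ g) =
      ‖mulOp _ (isBddSymbol_jap (div_nonneg hα zero_le_two)) g‖ ^ 2 +
        ‖mulOp _ (isBddSymbol_highSymbol hα) g‖ ^ 2 := by
  have hi : ∀ f : L2, Integrable fun x => ‖f x‖ ^ 2 := fun f => (Lp.memLp f).integrable_norm_pow (by norm_num)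
  rw [energy, opI_physical, opD_bessel hα, integral_add (hi _) (hi _), integral_norm_sq,
    integral_norm_sq, bessel, norm_fourierInv_L2, norm_fourierInv_L2]

theorem inner_mulOp_ofReal {r : ℝ → ℝ} (hr : IsBddSymbol fun η => (r η : ℂ)) (f h : L2) :
    (fun x => ⟪mulOp _ hr f x, mulOp _ hr h x⟫_ℝ) =ᵐ[volume]
      fun x => r x ^ 2 * ((starRingEnd ℂ) (f x) * h x).re := by
  filter_upwards [coeFn_mulOp hr f, coeFn_mulOp hr h] with x h1 h2
  rw [h1, h2, Complex.inner, map_mul, Complex.conj_ofReal, ← Complex.re_ofReal_mul]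
  congr 1
  push_cast
  ring

theorem cosh_add_div (x y : ℝ) :
    Real.cosh (x + y) * ((Real.cosh x)⁻¹ * (Real.cosh y)⁻¹) = 1 + Real.tanh x * Real.tanh y := by
  have hx := (Real.cosh_pos x).ne'
  have hy := (Real.cosh_pos y).ne'
  rw [Real.cosh_add, Real.tanh_eq_sinh_div_cosh, Real.tanh_eq_sinh_div_cosh]
  field_simp

/-- The remainder factor in `I(u²) - (I u)²` on the Fourier side. -/
noncomputable def tanhFactor (σ x y : ℝ) : ℝ :=
  Real.tanh (σ * (2 * Real.pi * y)) * Real.tanh (σ * (2 * Real.pi * (x - y)))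

/-- The energy density 1+|ξ|^α is exactly the denominator of the evolution symbol, so only the
symbol of ∂ₓ remains. -/
theorem energyDensity_mul_evReal (α x : ℝ) :
    ((jap x ^ (-(α / 2))) ^ 2 + highSymbol α x ^ 2) * evReal α x =
      2 * Real.pi * x * (jap x ^ (-(α / 2))) ^ 2 := by
  have h : (|2 * Real.pi * x| ^ (α / 2)) ^ 2 = |2 * Real.pi * x| ^ α := by
    rw [← Real.rpow_natCast, ← Real.rpow_mul (abs_nonneg _)]; congr 1; push_cast; ring
  have h0 := (one_add_abs_rpow_pos α (2 * Real.pi * x)).ne'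
  rw [highSymbol, mul_pow, h, evReal]
  field_simp

theorem weight_inv_eq (α σ x : ℝ) :
    (weight α σ x)⁻¹ = jap x ^ (-(α / 2)) * (Real.cosh (σ * (2 * Real.pi * x)))⁻¹ := by
  rw [weight, coshSymbol, mul_inv, Real.rpow_neg (jap_pos x).le]

/-- The quotient of hyperbolic cosines is 1 + tanh·tanh: the 1 belongs to (Iu)² and the rest to the
commutator I(u²) - (Iu)². -/
theorem flux_kernel_identity (α σ x y : ℝ) :
    ((jap x ^ (-(α / 2))) ^ 2 + highSymbol α x ^ 2) * evReal α x * weight α σ x *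
      ((weight α σ y)⁻¹ * (weight α σ (x - y))⁻¹) =
    2 * Real.pi * x * jap x ^ (-(α / 2)) * jap y ^ (-(α / 2)) * jap (x - y) ^ (-(α / 2)) *
      (1 + tanhFactor σ x y) := by
  have hx : jap x ^ (-(α / 2)) * jap x ^ (α / 2) = 1 := by
    rw [← Real.rpow_add (jap_pos x), neg_add_cancel, Real.rpow_zero]
  have hc := cosh_add_div (σ * (2 * Real.pi * y)) (σ * (2 * Real.pi * (x - y)))
  have e : σ * (2 * Real.pi * y) + σ * (2 * Real.pi * (x - y)) = σ * (2 * Real.pi * x) := by ring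
  rw [e] at hc
  rw [energyDensity_mul_evReal, weight_inv_eq, weight_inv_eq, tanhFactor, ← hc, weight, coshSymbol]
  linear_combination (2 * Real.pi * x * jap x ^ (-(α / 2)) * Real.cosh (σ * (2 * Real.pi * x)) *
    jap y ^ (-(α / 2)) * (Real.cosh (σ * (2 * Real.pi * y)))⁻¹ *
    jap (x - y) ^ (-(α / 2)) * (Real.cosh (σ * (2 * Real.pi * (x - y))))⁻¹) * hx

theorem re_conj_mul_vectorField (hα : 1 ≤ α) (hW : IsConvWeight (weight α σ) C) (g : L2) :
    (fun x => ((jap x ^ (-(α / 2))) ^ 2 + highSymbol α x ^ 2) *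
      ((starRingEnd ℂ) (g x) * vectorField hα hW g x).re) =ᵐ[volume]
    fun x => 1 / 2 * (∫ y, flux α g (x, y) * ((1 + tanhFactor σ x y : ℝ) : ℂ)).re := by
  rw [vectorField_eq]
  filter_upwards [coeFn_mulOp (isBddSymbol_evSymbol hα) (g + (1 / 2 : ℂ) • convOp _ hW g g),
    Lp.coeFn_add g ((1 / 2 : ℂ) • convOp _ hW g g), Lp.coeFn_smul (1 / 2 : ℂ) (convOp _ hW g g),
    coeFn_convOp hW g g] with x h1 h2 h3 h4
  set ρ := (jap x ^ (-(α / 2))) ^ 2 + highSymbol α x ^ 2 with hρ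
  set N := ∫ y, (((weight α σ y)⁻¹ : ℝ) : ℂ) * g y *
    ((((weight α σ (x - y))⁻¹ : ℝ) : ℂ) * g (x - y)) with hN
  have hint : ∫ y, flux α g (x, y) * ((1 + tanhFactor σ x y : ℝ) : ℂ) =
      (-Complex.I * ((ρ * evReal α x * weight α σ x : ℝ) : ℂ) * (starRingEnd ℂ) (g x)) * N := by
    rw [hN, ← integral_const_mul]
    congr 1
    ext y
    have hk := congrArg (fun r : ℝ => (r : ℂ)) (flux_kernel_identity α σ x y)
    simp only [flux, lowered, map_mul, Complex.conj_ofReal]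
    rw [← hρ] at hk
    push_cast at hk ⊢
    linear_combination (Complex.I * (starRingEnd ℂ) (g x) * g y * g (x - y)) * hk
  rw [hint, h1, h2, Pi.add_apply, h3, Pi.smul_apply, h4, smul_eq_mul, weightedConv, ← hN,
    evSymbol, ← Complex.re_ofReal_mul, ← Complex.re_ofReal_mul (1 / 2)]
  -- The linear part contributes a purely imaginary number, which the real part discards.
  have hz : ((ρ * evReal α x : ℝ) : ℂ) * (-Complex.I * ((starRingEnd ℂ) (g x) * g x)) =
      ((-(ρ * evReal α x * Complex.normSq (g x)) : ℝ) : ℂ) * Complex.I := by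
    rw [← Complex.normSq_eq_conj_mul_self]; push_cast; ring
  have hsplit : (ρ : ℂ) * ((starRingEnd ℂ) (g x) * (-Complex.I * (evReal α x : ℂ) *
      (g x + 1 / 2 * ((weight α σ x : ℂ) * N)))) =
      ((ρ * evReal α x : ℝ) : ℂ) * (-Complex.I * ((starRingEnd ℂ) (g x) * g x)) +
      ((1 / 2 : ℝ) : ℂ) *
        ((-Complex.I * ((ρ * evReal α x * weight α σ x : ℝ) : ℂ) * (starRingEnd ℂ) (g x)) * N) := by
    push_cast; ring
  rw [hsplit, hz, Complex.add_re, Complex.re_ofReal_mul, Complex.I_re, mul_zero, zero_add]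

theorem abs_tanhFactor_le_one (σ x y : ℝ) : |tanhFactor σ x y| ≤ 1 := by
  rw [tanhFactor, abs_mul]
  exact mul_le_one₀ (abs_tanh_le_one _) (abs_nonneg _) (abs_tanh_le_one _)

theorem measurable_tanhFactor (σ : ℝ) : Measurable (Function.uncurry (tanhFactor σ)) := by
  unfold tanhFactor Function.uncurry
  simp only [Real.tanh_eq_sinh_div_cosh]
  fun_prop

theorem integrable_flux_mul_tanhFactor (hα : 1 < α) (σ : ℝ) (g : L2) :
    Integrable (fun p : ℝ × ℝ => flux α g p * (tanhFactor σ p.1 p.2 : ℂ))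
      (volume.prod volume) := by
  refine (integrable_flux hα g).mul_bdd (c := 1) ?_ ?_
  · exact (Complex.measurable_ofReal.comp (measurable_tanhFactor σ)).aestronglyMeasurable
  · exact Eventually.of_forall fun p => by
      rw [Complex.norm_real]; exact abs_tanhFactor_le_one σ p.1 p.2

/-- Half of the time derivative of the energy along the flow. -/
theorem inner_vectorField (hα : 1 < α) (hW : IsConvWeight (weight α σ) C) {g : L2}
    (hg : conjNeg g = g) :
    ⟪mulOp _ (isBddSymbol_jap (div_nonneg (zero_lt_one.trans hα).le zero_le_two)) g,
        mulOp _ (isBddSymbol_jap (div_nonneg (zero_lt_one.trans hα).le zero_le_two))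
          (vectorField hα.le hW g)⟫_ℝ +
      ⟪mulOp _ (isBddSymbol_highSymbol (zero_lt_one.trans hα).le) g,
        mulOp _ (isBddSymbol_highSymbol (zero_lt_one.trans hα).le)
          (vectorField hα.le hW g)⟫_ℝ =
    1 / 2 * (∫ p : ℝ × ℝ, flux α g p * (tanhFactor σ p.1 p.2 : ℂ) ∂(volume.prod volume)).re := by
  have iF := integrable_flux hα g
  have iT := integrable_flux_mul_tanhFactor hα σ g
  have iS : Integrable (fun p : ℝ × ℝ => flux α g p * ((1 + tanhFactor σ p.1 p.2 : ℝ) : ℂ))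
      (volume.prod volume) := (iF.add iT).congr (Eventually.of_forall fun p => by
    simp only [Pi.add_apply]; push_cast; ring)
  have eS : ∫ p : ℝ × ℝ, flux α g p * ((1 + tanhFactor σ p.1 p.2 : ℝ) : ℂ) ∂(volume.prod volume) =
      ∫ p : ℝ × ℝ, flux α g p * (tanhFactor σ p.1 p.2 : ℂ) ∂(volume.prod volume) := by
    rw [← zero_add (∫ p : ℝ × ℝ, flux α g p * (tanhFactor σ p.1 p.2 : ℂ) ∂(volume.prod volume)),
      ← integral_flux_eq_zero hα hg, ← integral_add iF iT]
    congr 1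
    ext p
    push_cast
    ring
  rw [L2.inner_def, L2.inner_def, ← integral_add (L2.integrable_inner _ _)
    (L2.integrable_inner _ _), ← eS, integral_prod _ iS]
  have hre : (∫ x, ∫ y, flux α g (x, y) * ((1 + tanhFactor σ x y : ℝ) : ℂ)).re =
      ∫ x, (∫ y, flux α g (x, y) * ((1 + tanhFactor σ x y : ℝ) : ℂ)).re :=
    (integral_re iS.integral_prod_left).symm
  rw [hre, ← integral_const_mul]
  apply integral_congr_ae
  filter_upwards [inner_mulOp_ofReal
      (isBddSymbol_jap (div_nonneg (zero_lt_one.trans hα).le zero_le_two)) g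
      (vectorField hα.le hW g),
    inner_mulOp_ofReal (isBddSymbol_highSymbol (zero_lt_one.trans hα).le) g
      (vectorField hα.le hW g), re_conj_mul_vectorField hα.le hW g] with x h1 h2 h3
  rw [← h3, h1, h2, add_mul]

theorem beta_eq (α : ℝ) : beta α = 2 * (3 * (min α (7 / 3) - 1) / 4) := by
  unfold beta
  split_ifs with h
  · rw [min_eq_left h.le]; ring
  · rw [min_eq_right (not_lt.1 h)]; norm_num

/-- Allowing a smaller exponent a lets large α be treated as 7/3; dropping the 1 in 1+|ξ| makes the
weight homogeneous. -/
theorem jap_rpow_le_abs_rpow {a : ℝ} (ha : 0 ≤ a) (haα : a ≤ α) {x : ℝ} (hx : x ≠ 0) :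
    jap x ^ (-(α / 2)) ≤ |2 * Real.pi * x| ^ (-(a / 2)) := by
  have h0 : 0 < |2 * Real.pi * x| := abs_pos.2 (mul_ne_zero (by positivity) hx)
  calc jap x ^ (-(α / 2)) ≤ jap x ^ (-(a / 2)) :=
        Real.rpow_le_rpow_of_exponent_le (one_le_jap x) (by linarith)
    _ ≤ _ := Real.rpow_le_rpow_of_nonpos h0 (by unfold jap; linarith) (by linarith)

theorem jap_rpow_mul_abs_tanh_le {a θ : ℝ} (hσ : 0 < σ) (ha : 0 ≤ a) (haα : a ≤ α) (h0 : 0 ≤ θ)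
    (h1 : θ ≤ 1) {x : ℝ} (hx : x ≠ 0) :
    jap x ^ (-(α / 2)) * |Real.tanh (σ * (2 * Real.pi * x))| ≤
      σ ^ θ * (2 * Real.pi) ^ (-(a / 2 - θ)) * |x| ^ (-(a / 2 - θ)) := by
  have hp : 0 < |2 * Real.pi * x| := abs_pos.2 (mul_ne_zero (by positivity) hx)
  have h2 := jap_rpow_le_abs_rpow ha haα hx
  have h3 := abs_tanh_le_rpow h0 h1 (σ * (2 * Real.pi * x))
  have e1 : |σ * (2 * Real.pi * x)| ^ θ = σ ^ θ * |2 * Real.pi * x| ^ θ := by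
    rw [abs_mul, abs_of_pos hσ, Real.mul_rpow hσ.le hp.le]
  have e2 : |2 * Real.pi * x| ^ (-(a / 2)) * |2 * Real.pi * x| ^ θ =
      (2 * Real.pi) ^ (-(a / 2 - θ)) * |x| ^ (-(a / 2 - θ)) := by
    rw [← Real.rpow_add hp, abs_mul, abs_of_pos (by positivity : 0 < 2 * Real.pi),
      Real.mul_rpow (by positivity) (abs_nonneg x)]
    congr 2 <;> ring
  calc _ ≤ |2 * Real.pi * x| ^ (-(a / 2)) * |σ * (2 * Real.pi * x)| ^ θ :=
        mul_le_mul h2 h3 (abs_nonneg _) (Real.rpow_nonneg (abs_nonneg _) _)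
    _ = σ ^ θ * (|2 * Real.pi * x| ^ (-(a / 2)) * |2 * Real.pi * x| ^ θ) := by rw [e1]; ring
    _ = _ := by rw [e2]; ring

theorem fluxKernel_mul_tanhFactor_le {a θ : ℝ} (hσ : 0 < σ) (ha : 0 ≤ a) (haα : a ≤ α)
    (h0 : 0 ≤ θ) (h1 : θ ≤ 1) (x y : ℝ) :
    fluxKernel α x y * |tanhFactor σ x y| ≤
      σ ^ (2 * θ) * ((2 * Real.pi) ^ (-(a / 2 - 1)) * ((2 * Real.pi) ^ (-(a / 2 - θ))) ^ 2) *
        (|x| ^ (-(a / 2 - 1)) * |y| ^ (-(a / 2 - θ)) * |x - y| ^ (-(a / 2 - θ))) := by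
  have hr : 0 ≤ σ ^ (2 * θ) *
      ((2 * Real.pi) ^ (-(a / 2 - 1)) * ((2 * Real.pi) ^ (-(a / 2 - θ))) ^ 2) *
        (|x| ^ (-(a / 2 - 1)) * |y| ^ (-(a / 2 - θ)) * |x - y| ^ (-(a / 2 - θ))) := by positivity
  -- On the three degenerate lines negative powers of 0 are not usable, but there the left side
  -- vanishes through its factor |ξ| or a tanh.
  by_cases hx : x = 0
  · refine le_trans (le_of_eq ?_) hr
    rw [fluxKernel, hx]; simp
  by_cases hy : y = 0
  · refine le_trans (le_of_eq ?_) hr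
    rw [tanhFactor, hy]; simp
  by_cases hz : x - y = 0
  · refine le_trans (le_of_eq ?_) hr
    rw [tanhFactor, hz]; simp
  have b2 := jap_rpow_mul_abs_tanh_le hσ ha haα h0 h1 hy
  have b3 := jap_rpow_mul_abs_tanh_le hσ ha haα h0 h1 hz
  have hp : 0 < |2 * Real.pi * x| := abs_pos.2 (mul_ne_zero (by positivity) hx)
  have b1 : |2 * Real.pi * x| * jap x ^ (-(α / 2)) ≤
      (2 * Real.pi) ^ (-(a / 2 - 1)) * |x| ^ (-(a / 2 - 1)) := by
    have e : |2 * Real.pi * x| * |2 * Real.pi * x| ^ (-(a / 2)) =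
        (2 * Real.pi) ^ (-(a / 2 - 1)) * |x| ^ (-(a / 2 - 1)) := by
      nth_rewrite 1 [← Real.rpow_one |2 * Real.pi * x|]
      rw [← Real.rpow_add hp, abs_mul, abs_of_pos (by positivity : 0 < 2 * Real.pi),
        Real.mul_rpow (by positivity) (abs_nonneg x)]
      congr 2 <;> ring
    rw [← e]
    exact mul_le_mul_of_nonneg_left (jap_rpow_le_abs_rpow ha haα hx) hp.le
  have hs : σ ^ (2 * θ) = σ ^ θ * σ ^ θ := by rw [two_mul, Real.rpow_add hσ]
  have n2 := jap_rpow_nonneg y (-(α / 2))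
  have n3 := jap_rpow_nonneg (x - y) (-(α / 2))
  calc fluxKernel α x y * |tanhFactor σ x y|
      = (|2 * Real.pi * x| * jap x ^ (-(α / 2))) *
        (jap y ^ (-(α / 2)) * |Real.tanh (σ * (2 * Real.pi * y))|) *
        (jap (x - y) ^ (-(α / 2)) * |Real.tanh (σ * (2 * Real.pi * (x - y)))|) := by
        rw [fluxKernel, tanhFactor, abs_mul (Real.tanh _)]; ring
    _ ≤ ((2 * Real.pi) ^ (-(a / 2 - 1)) * |x| ^ (-(a / 2 - 1))) *
        (σ ^ θ * (2 * Real.pi) ^ (-(a / 2 - θ)) * |y| ^ (-(a / 2 - θ))) *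
        (σ ^ θ * (2 * Real.pi) ^ (-(a / 2 - θ)) * |x - y| ^ (-(a / 2 - θ))) := by
        gcongr
    _ = _ := by rw [hs]; ring

/-- The energy changes along the flow at a rate of at most `σ ^ β ‖g‖³`. -/
theorem exists_norm_integral_flux_le (hα : 1 < α) : ∃ K : ℝ, 0 ≤ K ∧ ∀ σ : ℝ, 0 < σ → ∀ g : L2,
    ‖∫ p : ℝ × ℝ, flux α g p * (tanhFactor σ p.1 p.2 : ℂ) ∂(volume.prod volume)‖ ≤
      K * σ ^ beta α * ‖g‖ ^ 3 := by
  set a := min α (7 / 3) with ha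
  have ha1 : 1 < a := lt_min hα (by norm_num)
  have ha2 : a ≤ 7 / 3 := min_le_right _ _
  set θ := 3 * (a - 1) / 4 with hθ
  -- With θ = 3(a-1)/4 one has p = (3-a)/4, so 0 < p < 1/2 follows from 1 < a ≤ 7/3, and 2p+q = 1/2.
  obtain ⟨K, hK, hKg⟩ := triIntegral_homogeneous_le (p := a / 2 - θ) (q := a / 2 - 1)
    (by rw [hθ]; linarith) (by rw [hθ]; linarith) (by rw [hθ]; ring)
  set D := (2 * Real.pi) ^ (-(a / 2 - 1)) * ((2 * Real.pi) ^ (-(a / 2 - θ))) ^ 2 with hD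
  have hD0 : 0 ≤ D := by positivity
  refine ⟨D * K, by positivity, fun σ hσ g => ?_⟩
  have hβ : beta α = 2 * θ := beta_eq α
  have hc : 0 ≤ σ ^ (2 * θ) * D := by positivity
  have hm : Measurable (Function.uncurry fun x y =>
      ENNReal.ofReal (fluxKernel α x y * |tanhFactor σ x y|)) :=
    ((measurable_fluxKernel α).mul (measurable_tanhFactor σ).abs).ennreal_ofReal
  have key : ‖∫ p : ℝ × ℝ, flux α g p * (tanhFactor σ p.1 p.2 : ℂ) ∂(volume.prod volume)‖ₑ ≤
      ENNReal.ofReal (σ ^ (2 * θ) * D * (K * ‖g‖ ^ 3)) := by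
    calc _ ≤ ∫⁻ p : ℝ × ℝ, ‖flux α g p * (tanhFactor σ p.1 p.2 : ℂ)‖ₑ ∂(volume.prod volume) :=
          enorm_integral_le_lintegral_enorm _
      _ = triIntegral (fun x y => ENNReal.ofReal (fluxKernel α x y * |tanhFactor σ x y|)) g := by
          rw [triIntegral_eq_prod hm]
          refine lintegral_congr fun p => ?_
          rw [enorm_mul, enorm_flux, ← ofReal_norm (tanhFactor σ p.1 p.2 : ℂ), Complex.norm_real,
            Real.norm_eq_abs, ENNReal.ofReal_mul (fluxKernel_nonneg _ _ _)]
          ring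
      _ ≤ triIntegral (fun x y => ENNReal.ofReal (σ ^ (2 * θ) * D) * ENNReal.ofReal
            (|x| ^ (-(a / 2 - 1)) * |y| ^ (-(a / 2 - θ)) * |x - y| ^ (-(a / 2 - θ)))) g := by
          refine triIntegral_mono (fun x y => ?_) g
          rw [← ENNReal.ofReal_mul hc]
          exact ENNReal.ofReal_le_ofReal (fluxKernel_mul_tanhFactor_le hσ (by linarith)
            (min_le_left _ _) (by rw [hθ]; linarith) (by rw [hθ]; linarith) x y)
      _ ≤ ENNReal.ofReal (σ ^ (2 * θ) * D) * ENNReal.ofReal (K * ‖g‖ ^ 3) := by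
          rw [triIntegral_const_mul ENNReal.ofReal_ne_top]
          gcongr
          exact hKg g
      _ = _ := (ENNReal.ofReal_mul hc).symm
  rw [← ofReal_norm, ENNReal.ofReal_le_ofReal_iff (by positivity)] at key
  rw [hβ]
  linarith

/-- In terms of g the energy is a sum of squared norms of bounded operators, so it is differentiable
wherever g is. -/
theorem hasDerivWithinAt_energy (hα : 1 < α) (hW : IsConvWeight (weight α σ) C) {g : ℝ → L2}
    {J : Set ℝ} {t : ℝ} (hg : conjNeg (g t) = g t)
    (hd : HasDerivWithinAt g (vectorField hα.le hW (g t)) J t) :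
    HasDerivWithinAt (fun s => energy α σ (physical (zero_lt_one.trans hα).le σ (g s)))
      (∫ p : ℝ × ℝ, flux α (g t) p * (tanhFactor σ p.1 p.2 : ℂ) ∂(volume.prod volume)).re J t := by
  have hα0 := (zero_lt_one.trans hα).le
  have hM : ∀ {r : ℝ → ℂ} (hr : IsBddSymbol r), HasDerivWithinAt (fun s => ‖mulOp r hr (g s)‖ ^ 2)
      (2 * ⟪mulOp r hr (g t), mulOp r hr (vectorField hα.le hW (g t))⟫_ℝ) J t := fun hr =>
    (((mulOp _ hr).restrictScalars ℝ).hasFDerivAt.comp_hasDerivWithinAt t hd).norm_sq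
  simp only [energy_physical]
  refine ((hM _).add (hM _)).congr_deriv ?_
  rw [← mul_add, inner_vectorField hα hW hg]
  ring

theorem exists_energy_le (hα : 1 < α) (hW : ∀ σ, IsConvWeight (weight α σ) C) :
    ∃ K : ℝ, 0 < K ∧ ∀ σ : ℝ, 0 < σ → ∀ u₀ : L2, ∀ δ : ℝ, 0 < δ → ∀ u : ℝ → L2,
      IsSolution α σ δ u₀ u → LocalBound α σ δ u₀ u →
        energy α σ (u δ) ≤
          energy α σ (u 0) + K * δ * σ ^ beta α * normHs (α / 2) (opI σ u₀) ^ 3 := by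
  obtain ⟨K, hK, hKg⟩ := exists_norm_integral_flux_le hα
  -- The 8 is the cube of the factor 2 in the local bound; the `+ 1` only ensures positivity, as K
  -- may be 0.
  refine ⟨8 * K + 1, by positivity, fun σ hσ u₀ δ hδ u hu hb => ?_⟩
  obtain ⟨g, hgu, hgr, hgd⟩ := hu.exists_curve hα hσ (hW σ)
  have hα0 := (zero_lt_one.trans hα).le
  have m0 : (0 : ℝ) ∈ Icc 0 δ := ⟨le_rfl, hδ.le⟩
  have mδ : δ ∈ Icc 0 δ := ⟨hδ.le, le_rfl⟩
  have hpi : 1 ≤ Real.sqrt (2 * Real.pi) :=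
    Real.one_le_sqrt.2 (by linarith [Real.pi_gt_three])
  have hu0 : u₀ = physical hα0 σ (g 0) := by rw [hgu 0 m0, hu.initial]
  have hn0 : normHs (α / 2) (opI σ u₀) = Real.sqrt (2 * Real.pi) * ‖g 0‖ := by
    rw [hu0, normHs_opI_physical]
  have hbound : ∀ t ∈ Icc 0 δ, ‖g t‖ ≤ 2 * ‖g 0‖ := fun t ht => by
    have h := hb t ht
    rw [hn0, ← hgu t ht, normHs_opI_physical] at h
    have : Real.sqrt (2 * Real.pi) * ‖g t‖ ≤ Real.sqrt (2 * Real.pi) * (2 * ‖g 0‖) := by linarith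
    exact le_of_mul_le_mul_left this (by linarith)
  have hmv := (convex_Icc (0 : ℝ) δ).norm_image_sub_le_of_norm_hasDerivWithin_le
    (C := K * σ ^ beta α * (2 * ‖g 0‖) ^ 3)
    (fun t ht => hasDerivWithinAt_energy hα (hW σ) (hgr t ht) (hgd t ht))
    (fun t ht => by
      refine (Complex.abs_re_le_norm _).trans ((hKg σ hσ (g t)).trans ?_)
      have := hbound t ht
      gcongr) m0 mδ
  rw [hgu 0 m0, hgu δ mδ, Real.norm_eq_abs, sub_zero, Real.norm_of_nonneg hδ.le] at hmv
  have h1 := (abs_le.1 hmv).2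
  have hg3 : ‖g 0‖ ^ 3 ≤ normHs (α / 2) (opI σ u₀) ^ 3 := by
    rw [hn0]
    have := norm_nonneg (g 0)
    gcongr
    exact le_mul_of_one_le_left this hpi
  have hs : 0 ≤ δ * σ ^ beta α := by positivity
  have h2 : K * σ ^ beta α * (2 * ‖g 0‖) ^ 3 * δ ≤
      (8 * K + 1) * δ * σ ^ beta α * normHs (α / 2) (opI σ u₀) ^ 3 := by
    calc _ = 8 * K * (δ * σ ^ beta α) * ‖g 0‖ ^ 3 := by ring
      _ ≤ (8 * K + 1) * (δ * σ ^ beta α) * normHs (α / 2) (opI σ u₀) ^ 3 := by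
          gcongr
          linarith
      _ = _ := by ring
  linarith

end Energy

end FBBM

open FBBM in
theorem mainTheorem4 (α : ℝ) (hα : 1 < α) :
    ∃ c : ℝ, 0 < c ∧ ∃ C : ℝ, 0 < C ∧
      ∀ σ : ℝ, 0 < σ → ∀ u₀ : L2, IsRealValued u₀ → OpIMemHs σ (α / 2) u₀ →
        (∀ δ : ℝ, 0 < δ → δ * normHs (α / 2) (opI σ u₀) ≤ c →
          ∃ u : ℝ → L2, IsSolution α σ δ u₀ u ∧ LocalBound α σ δ u₀ u ∧
            ∀ v : ℝ → L2, IsSolution α σ δ u₀ v → EqOn v u (Icc 0 δ)) ∧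
        (∀ δ : ℝ, 0 < δ → ∀ u : ℝ → L2, IsSolution α σ δ u₀ u → LocalBound α σ δ u₀ u →
          energy α σ (u δ) ≤
            energy α σ (u 0) + C * δ * σ ^ beta α * normHs (α / 2) (opI σ u₀) ^ 3) := by
  obtain ⟨C, hC, hW⟩ := exists_isConvWeight hα
  obtain ⟨K, hK, hE⟩ := exists_energy_le hα hW
  -- This c is the Picard condition 4Cδ‖g(0)‖ ≤ 1 rewritten with ‖Iu₀‖_{H^{α/2}} = √(2π)‖g(0)‖.
  refine ⟨Real.sqrt (2 * Real.pi) / (4 * C), by positivity, K, hK, fun σ hσ u₀ hr hu₀ =>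
    ⟨fun δ hδ hsmall => exists_solution hα hσ (hW σ) hr hu₀ hδ ?_, hE σ hσ u₀⟩⟩
  rw [le_div_iff₀ (by positivity)] at hsmall
  linarith
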